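/- Let $\mathbb F$ be an algebraically closed field of characteristic $0$, let $\mathfrak g$ be a finite-dimensional Lie algebra over $\mathbb F$ with a non-degenerate symmetric invariant bilinear form $(\cdot|\cdot)$ (for example, a reductive one), and let $\{e,h,f\}$ be an $\mathfrak{sl}_2$-triple in $\mathfrak g$. For $k\in\frac12\mathbb Z$ put $\mathfrak g_k=\{a\in\mathfrak g : [h,a]=2ka\}$, and let $\omega(a,b)=(f|[a,b])$ for $a,b\in\mathfrak g_{1/2}$. Let $(f_1,f_2,E)$ be an integrable triple for $f$: $f_1,f_2\in\mathfrak g_{-1}$, $0\ne E\in\mathfrak g_k$ for some $k\ge\frac12$, $f=f_1+f_2$, $[f_1,f_2]=[f_2,E]=0$, $[E,\mathfrak g_{\ge1}]=0$, the centralizer of $E$ in $\mathfrak g_{1/2}$ is coisotropic for $\omega$, and $\operatorname{ad}(f_1+E)$ is semisimple. Let $\mathfrak l\subset\mathfrak g_{1/2}$ be an isotropic subspace whose $\omega$-orthocomplement in $\mathfrak g_{1/2}$ is the centralizer of $E$ in $\mathfrak g_{1/2}$, let $\mathfrak m=\mathfrak l\oplus\mathfrak g_{\ge1}$, and let $\mathfrak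 p$ be a complement of $\mathfrak m$ in $\mathfrak g$ with $\mathfrak g_{\le0}\subset\mathfrak p\subset\mathfrak g_{\le1/2}$. Let $\mathcal V(\mathfrak p)$ be the algebra of differential polynomials over $\mathfrak p$, with derivation $\partial$: for a basis $\{q_i\}$ of $\mathfrak p$ it is the polynomial algebra in the variables $q_i^{(n)}$, $n\ge0$, with $q_i^{(0)}=q_i$ and $\partial q_i^{(n)}=q_i^{(n+1)}$. Let $\{q^i\}$ be the dual basis of $\mathfrak m^\perp$, $(q^j|q_i)=\delta_{ij}$, and let $q=\sum_i q_i\otimes q^i$. Give $z$ degree $-k-1$ and elements of $\mathfrak g_j$ degree $j$; a subscript such as $>0$ denotes the part of $\mathfrak g((z^{-1}))$, or of a graded subspace of it, spanned (allowing infinite series) by homogeneous elements of such degrees. Let $\mathfrak h=\ker\operatorname{ad}(f_1+zE)$ and $\mathfrak h^\perp=\operatorname{im}\operatorname{ad}(f_1+zE)$ in $\mathfrak g((z^{-1}))$. Tensor products $\mathcal V(\mathfrak p)\otimes W$ with $W\subset\mathfrak g((z^{-1}))$ are completed: they are taken inside the space of Laurent series in $z^{-1}$ with coefficients in $\mathcal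 V(\mathfrak p)\otimes\mathfrak g$, and infinite sums of terms of increasing degrees are allowed. Let $\widetilde{\mathfrak g}=\mathbb F\partial\ltimes(\mathcal V(\mathfrak p)\otimes\mathfrak g((z^{-1})))$, where $\partial$ acts on the first factor. (a) For every $U(z)\in\mathcal V(\mathfrak p)\otimes\mathfrak g((z^{-1}))_{>0}$ the series $e^{\operatorname{ad}U(z)}$ converges to a well-defined Lie algebra automorphism of $\widetilde{\mathfrak g}$. (b) There are unique $U(z)\in\mathcal V(\mathfrak p)\otimes\mathfrak h^\perp_{>0}$ and $h(z)\in\mathcal V(\mathfrak p)\otimes\mathfrak h_{>-1}$ such that $$e^{\operatorname{ad}U(z)}\bigl(\partial+1\otimes(f+zE)+q\bigr)=\partial+1\otimes(f+zE)+h(z).\qquad(*)$$ (c) The automorphism $e^{\operatorname{ad}U(z)}$ with $U(z)\in\mathcal V(\mathfrak p)\otimes\mathfrak g((z^{-1}))_{>0}$ that solves $(*)$ for some $h(z)\in\mathcal V(\mathfrak p)\otimes\mathfrak h_{>-1}$ is unique exactly up to left multiplication by the automorphisms $e^{\operatorname{ad}S(z)}$, $S(z)\in\mathcal V(\mathfrak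 p)\otimes\mathfrak h_{>0}$: if $\varphi$ is one such automorphism, then the set of all of them is $\{e^{\operatorname{ad}S(z)}\circ\varphi : S(z)\in\mathcal V(\mathfrak p)\otimes\mathfrak h_{>0}\}$. -/

import Mathlib

open scoped TensorProduct

attribute [local instance 2000] HahnSeries.instAlgebra
attribute [local instance 100] LieRing.ofAssociativeRing LieAlgebra.ofAssociativeAlgebra

noncomputable section

namespace DrinfeldSokolov

/-! ### The grading attached to an `sl₂`-triple, and integrable triples

All half-integral degrees are doubled: the integer `j` stands for the degree `j / 2`. -/

section Grading

variable {F : Type*} [Field F] {g : Type*} [LieRing g] [LieAlgebra F g]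

/-- The graded piece `g_{j/2} = {a | [h, a] = 2 (j/2) a}`. -/
def grade (F : Type*) [Field F] {g : Type*} [LieRing g] [LieAlgebra F g] (h : g) (j : ℤ) :
    Submodule F g where
  carrier := {a | ⁅h, a⁆ = (j : F) • a}
  add_mem' := by
    intro a b ha hb
    simp only [Set.mem_ofPred_eq] at ha hb ⊢
    rw [lie_add, ha, hb, smul_add]
  zero_mem' := by simp
  smul_mem' := by
    intro c a ha
    simp only [Set.mem_ofPred_eq] at ha ⊢
    rw [lie_smul, ha, smul_comm]

/-- The sum of the graded pieces `g_{j/2}`, `j ∈ S`. For example `S = Set.Ici 2` gives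
`g_{≥ 1}`, and `S = Set.Ioi j` gives `g_{> j/2}`. -/
def gradeSum (F : Type*) [Field F] {g : Type*} [LieRing g] [LieAlgebra F g] (h : g) (S : Set ℤ) :
    Submodule F g :=
  ⨆ j ∈ S, grade F h j

/-- The centralizer of `E` in `g_{1/2}`. -/
def centralizerHalf (F : Type*) [Field F] {g : Type*} [LieRing g] [LieAlgebra F g] (h E : g) :
    Submodule F g :=
  grade F h 1 ⊓ LinearMap.ker (LieAlgebra.ad F g E)

/-- The orthocomplement in `g_{1/2}` of a subspace `C`, with respect to the skew-symmetric form
`ω(a, b) = (f | [a, b])`. -/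
def omegaOrtho (Φ : LinearMap.BilinForm F g) (h f : g) (C : Submodule F g) : Submodule F g where
  carrier := {a | a ∈ grade F h 1 ∧ ∀ b ∈ C, Φ f ⁅a, b⁆ = 0}
  add_mem' := by
    rintro a b ⟨ha, ha'⟩ ⟨hb, hb'⟩
    exact ⟨add_mem ha hb, fun c hc => by rw [add_lie, map_add, ha' c hc, hb' c hc, add_zero]⟩
  zero_mem' := ⟨zero_mem _, by simp⟩
  smul_mem' := by
    rintro t a ⟨ha, ha'⟩
    exact ⟨Submodule.smul_mem _ t ha, fun c hc => by rw [smul_lie, map_smul, ha' c hc, smul_zero]⟩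

/-- A subspace on which `ω(a, b) = (f | [a, b])` vanishes. -/
def IsIsotropic (Φ : LinearMap.BilinForm F g) (f : g) (C : Submodule F g) : Prop :=
  ∀ a ∈ C, ∀ b ∈ C, Φ f ⁅a, b⁆ = 0

/-- `(f₁, f₂, E)` is an integrable triple associated to `f`, with `E ∈ g_{κ/2}`, `κ/2 ≥ 1/2`.
Here `h` is the semisimple element of the `sl₂`-triple that defines the grading. -/
structure IsIntegrableTriple (Φ : LinearMap.BilinForm F g) (h f : g) (κ : ℤ) (f₁ f₂ E : g) :
    Prop where
  one_le : 1 ≤ κ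
  mem_f₁ : f₁ ∈ grade F h (-2)
  mem_f₂ : f₂ ∈ grade F h (-2)
  mem_E : E ∈ grade F h κ
  E_ne_zero : E ≠ 0
  add_eq : f = f₁ + f₂
  lie_f₁_f₂ : ⁅f₁, f₂⁆ = 0
  lie_E : ∀ a ∈ gradeSum F h (Set.Ici 2), ⁅E, a⁆ = 0
  coisotropic : IsIsotropic Φ f (omegaOrtho Φ h f (centralizerHalf F h E))
  semisimple : Module.End.IsSemisimple (LieAlgebra.ad F g (f₁ + E))
  lie_f₂_E : ⁅f₂, E⁆ = 0

end Grading

/-! ### Laurent series in `z⁻¹` with values in a Lie algebra -/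

section Loop

variable (F : Type*) [Field F]

/-- The `F`-linear map of Laurent series induced by a linear map of the coefficients. -/
def coeffMap {F : Type*} [Field F] {A B : Type*} [AddCommGroup A] [Module F A] [AddCommGroup B]
    [Module F B] (φ : A →ₗ[F] B) : LaurentSeries A →ₗ[F] LaurentSeries B where
  toFun x := HahnSeries.map x φ
  map_add' x y := by ext n; simp
  map_smul' c x := by ext n; simp

/-- `A((z⁻¹)) ⊗ g`, with its Lie bracket `[a ⊗ x, b ⊗ y] = ab ⊗ [x, y]`. The variable of the
Laurent series is `z⁻¹`. For `A = F` this is `g((z⁻¹))`; since `g` is finite-dimensional, in general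
it is the space of Laurent series in `z⁻¹` with coefficients in `A ⊗ g`. -/
abbrev Loop (A : Type*) [CommRing A] [Algebra F A] (g : Type*) [LieRing g] [LieAlgebra F g] :
    Type _ :=
  LaurentSeries A ⊗[F] g

variable {F} {A : Type*} [CommRing A] [Algebra F A] {g : Type*} [LieRing g] [LieAlgebra F g]

/-- The coefficient of `z⁻ⁿ`. -/
def loopCoeff (n : ℤ) : Loop F A g →ₗ[F] A ⊗[F] g :=
  (HahnSeries.coeff.linearMap n : LaurentSeries A →ₗ[F] A).rTensor g

/-- The monomial `a zⁿ ⊗ x`. -/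
def monom (a : A) (n : ℤ) (x : g) : Loop F A g :=
  (HahnSeries.single (-n) a : LaurentSeries A) ⊗ₜ[F] x

/-- `A ⊗ g((z⁻¹))_{> j/2}` (completed), where `z` has degree `-κ/2 - 1` and `A` has degree `0`:
the coefficient of `z⁻ⁿ`, where `z⁻ⁿ` has degree `n (κ/2 + 1)`, must lie in
`A ⊗ g_{> j/2 - n (κ/2 + 1)}`. -/
def loopGT (F : Type*) [Field F] (A : Type*) [CommRing A] [Algebra F A] {g : Type*} [LieRing g]
    [LieAlgebra F g] (h : g) (κ : ℤ) (j : ℤ) : Submodule F (Loop F A g) :=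
  ⨅ n : ℤ, (((gradeSum F h (Set.Ioi (j - n * (κ + 2)))).baseChange A).restrictScalars F).comap
    (loopCoeff n)

/-- The element `a ⊗ x(z)`, for `a ∈ A` and `x(z) ∈ g((z⁻¹))`. -/
def pureLoop (a : A) : Loop F F g →ₗ[F] Loop F A g :=
  (coeffMap (LinearMap.toSpanSingleton F A a)).rTensor g

/-- The completed tensor product `A ⊗ W`, for a subspace `W` of `g((z⁻¹))`: the elements of
`A((z⁻¹)) ⊗ g` which, up to terms of arbitrarily high degree, are finite sums of elements
`a ⊗ x(z)` with `a ∈ A` and `x(z) ∈ W`. -/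
def hatTensor (A : Type*) [CommRing A] [Algebra F A] (h : g) (κ : ℤ)
    (W : Submodule F (Loop F F g)) : Submodule F (Loop F A g) :=
  ⨅ j : ℤ, Submodule.span F {y | ∃ a : A, ∃ x ∈ W, y = pureLoop a x} ⊔ loopGT F A h κ j

/-- `f + z E`. -/
def cyc (A : Type*) [CommRing A] [Algebra F A] (f E : g) : Loop F A g :=
  monom 1 0 f + monom 1 1 E

/-- `𝔥 = ker ad (f₁ + z E)` in `g((z⁻¹))`. -/
def kerAd (F : Type*) [Field F] {g : Type*} [LieRing g] [LieAlgebra F g] (f₁ E : g) :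
    Submodule F (Loop F F g) :=
  LinearMap.ker (LieAlgebra.ad F (Loop F F g) (cyc F f₁ E))

/-- `𝔥^⊥ = im ad (f₁ + z E)` in `g((z⁻¹))`. -/
def imAd (F : Type*) [Field F] {g : Type*} [LieRing g] [LieAlgebra F g] (f₁ E : g) :
    Submodule F (Loop F F g) :=
  LinearMap.range (LieAlgebra.ad F (Loop F F g) (cyc F f₁ E))

end Loop

/-! ### The Lie algebra `F ∂ ⋉ (V ⊗ g((z⁻¹)))` and exponentials -/

section Tilde

variable {F : Type*} [Field F] {V : Type*} [CommRing V] [Algebra F V]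

/-- A derivation of `V` acts coefficientwise on Laurent series, again as a derivation. -/
theorem coeffMap_leibniz (D : Derivation F V V) (x y : LaurentSeries V) :
    coeffMap D.toLinearMap (x * y)
      = x * coeffMap D.toLinearMap y + coeffMap D.toLinearMap x * y := by
  have hsub : ∀ u : LaurentSeries V, (coeffMap D.toLinearMap u).support ⊆ u.support := by
    intro u n hn hu
    apply hn
    have hu' : u.coeff n = 0 := by simpa using hu
    simp [coeffMap, hu']
  ext n
  rw [HahnSeries.coeff_add, HahnSeries.coeff_mul_right' y.isPWO_support (hsub y),
    HahnSeries.coeff_mul_left' x.isPWO_support (hsub x), ← Finset.sum_add_distrib]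
  simp [coeffMap, HahnSeries.coeff_mul, mul_comm]

variable (g : Type*) [LieRing g] [LieAlgebra F g]

/-- The derivation `∂` of `V((z⁻¹)) ⊗ g`, acting coefficientwise on the first factor. -/
def loopDeriv (D : Derivation F V V) : LieDerivation F (Loop F V g) (Loop F V g) where
  toLinearMap := (coeffMap D.toLinearMap).rTensor g
  leibniz' a b := by
    induction a using TensorProduct.induction_on with
    | zero => simp
    | add a a' ha ha' =>
      simp only [add_lie, lie_add, map_add] at *
      rw [ha, ha']
      abel
    | tmul s x =>
      induction b using TensorProduct.induction_on with
      | zero => simp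
      | add b b' hb hb' =>
        simp only [add_lie, lie_add, map_add] at *
        rw [hb, hb']
        abel
      | tmul t y =>
        simp only [LieAlgebra.ExtendScalars.bracket_tmul, LinearMap.rTensor_tmul,
          coeffMap_leibniz, TensorProduct.add_tmul]
        rw [← lie_skew y x, mul_comm t, TensorProduct.tmul_neg]
        abel

/-- The action of the one-dimensional Lie algebra `F ∂` on `V((z⁻¹)) ⊗ g`. -/
def derivAction (D : Derivation F V V) :
    F →ₗ⁅F⁆ LieDerivation F (Loop F V g) (Loop F V g) where
  toFun c := c • loopDeriv g D
  map_add' c d := add_smul c d _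
  map_smul' c d := by simp [mul_smul]
  map_lie' := by
    intro c d
    simp [LieRing.of_associative_ring_bracket, mul_comm c d]

/-- The Lie algebra `F ∂ ⋉ (V ⊗ g((z⁻¹)))`. -/
abbrev Tilde (D : Derivation F V V) : Type _ :=
  LieAlgebra.SemiDirectSum (Loop F V g) F (derivAction g D)

variable {g}

/-- The inclusion of `V ⊗ g((z⁻¹))`. -/
def incl (D : Derivation F V V) (x : Loop F V g) : Tilde g D :=
  LieAlgebra.SemiDirectSum.inl (derivAction g D) x

/-- The element `∂ + x`, for `x ∈ V ⊗ g((z⁻¹))`. -/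
def dPlus (D : Derivation F V V) (x : Loop F V g) : Tilde g D :=
  LieAlgebra.SemiDirectSum.inr (derivAction g D) 1 + incl D x

/-- The automorphism `φ` is `e^{ad U}`: for every `x`, the series `∑ₖ (ad U)ᵏ x / k!` converges to
`φ x`, in the sense that the remainders have degrees tending to infinity. -/
def IsExpAd (D : Derivation F V V) (h : g) (κ : ℤ) (U : Loop F V g)
    (φ : Tilde g D ≃ₗ⁅F⁆ Tilde g D) : Prop :=
  ∀ (x : Tilde g D) (j : ℤ), ∃ N : ℕ, ∀ n ≥ N, ∃ r ∈ loopGT F V h κ j,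
    φ x = ∑ k ∈ Finset.range n,
      ((k.factorial : F)⁻¹) • ((LieAlgebra.ad F (Tilde g D) (incl D U)) ^ k) x + incl D r

end Tilde

/-! ### Differential polynomials -/

section DiffPoly

variable (F : Type*) [Field F] (ι : Type*)

/-- The algebra of differential polynomials in the variables `q_i`, `i ∈ ι`; the variable
`X (i, n)` is the `n`-th derivative of `q_i = X (i, 0)`. -/
abbrev DiffPoly : Type _ := MvPolynomial (ι × ℕ) F

/-- The derivation `∂`, with `∂ q_i^{(n)} = q_i^{(n+1)}`. -/
def diffPolyD : Derivation F (DiffPoly F ι) (DiffPoly F ι) :=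
  MvPolynomial.mkDerivation F fun s => MvPolynomial.X (s.1, s.2 + 1)

end DiffPoly

/-- `q = ∑ᵢ qᵢ ⊗ qⁱ`, where the `qᵢ` are the differential variables and `qⁱ = qd i`. -/
def qElement {F : Type*} [Field F] {g : Type*} [LieRing g] [LieAlgebra F g] {ι : Type*}
    [Fintype ι] (qd : ι → g) : Loop F (DiffPoly F ι) g :=
  ∑ i, monom (MvPolynomial.X (i, 0)) 0 (qd i)

/-- The automorphisms `e^{ad U}`, with `U ∈ V ⊗ g((z⁻¹))_{>0}`, that take `∂ + f + z E + q` to an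
element `∂ + f + z E + h(z)` with `h(z) ∈ V ⊗ 𝔥_{>-1}`. -/
def solutionAutomorphisms {F : Type*} [Field F] {g : Type*} [LieRing g] [LieAlgebra F g]
    {ι : Type*} [Fintype ι] (h f : g) (κ : ℤ) (f₁ E : g) (qd : ι → g) :
    Set (Tilde g (diffPolyD F ι) ≃ₗ⁅F⁆ Tilde g (diffPolyD F ι)) :=
  {φ | ∃ U ∈ loopGT F (DiffPoly F ι) h κ 0, IsExpAd (diffPolyD F ι) h κ U φ ∧
    ∃ H ∈ hatTensor (DiffPoly F ι) h κ (kerAd F f₁ E ⊓ loopGT F F h κ (-2)),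
      φ (dPlus _ (cyc (DiffPoly F ι) f E + qElement qd))
        = dPlus _ (cyc (DiffPoly F ι) f E + H)}

end DrinfeldSokolov

end

/-!
Write `s = f₁ + z E` and `N = ad f₂`. In doubled degrees `s` and `f₂` are homogeneous of degree
`-2`, while `∂` and, by non-degeneracy and invariance of the form, `q` have components of degree at
least `-1` only. So the leading part of `∂ + f + z E + q` is `s + f₂ = f + z E`, and the exponent
`U` can be found degree by degree, as soon as the following linear algebra is available.

* The grading. By `sl₂`-theory `ad h` is diagonalizable with integral eigenvalues
  (`iSup_eigenspace_int_eq_top`), so `g` has a homogeneous basis. In the coordinates of such a basis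
  the degree filtration of `V ⊗ g((z⁻¹))` is seen to be separated, exhaustive and complete
  (`loopFil_complete`).
* The splitting. As `T = ad (f₁ + E)` is semisimple, `T² r(T) = T` for some polynomial `r`. Giving
  each term of `r(T)` the power of `z` that makes it homogeneous of degree `2` (and dropping it if
  there is none) turns `r(T)` into an operator `R` on `V ⊗ g((z⁻¹))`, which commutes with `ad s` and
  satisfies `ad s ∘ R ∘ ad s = ad s` (`isSplitting_loop`). Hence `ad s ∘ R` is a projection onto
  `im ad s` along `ker ad s` that preserves the filtration, and the completed tensor products with
  `𝔥` and `𝔥^⊥` are the kernel and the image of `ad s` on `V ⊗ g((z⁻¹))`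
  (`hatTensor_eq_of_projection`).
* The perturbation. `N` is nilpotent and commutes with `ad s` and `R`, so `ad s + N` is invertible
  on `im ad s`, with an inverse of degree `2` (`IsSplitting.exists_solution`,
  `IsSplitting.mem_of_apply_mem`).

For (a), in a Lie algebra with a complete filtration `e^{ad U}` converges to an automorphism for
every `U` of positive degree (`CompleteFiltration.exists_exp`); this is applied to the semidirect
sum `F ∂ ⋉ (V ⊗ g((z⁻¹)))`. For (b), changing `U` by a term `u` of degree `d` changes `e^{ad U} X`
by `⁅u, X⁆` up to terms of higher degree (`CompleteFiltration.isExp_sub_sub_mem`), so that in each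
degree one has to solve `(ad s + N) u + q = y` with `u ∈ im ad s` and `q ∈ ker ad s`, uniquely in
`u`; see `CompleteFiltration.exists_exp_eq` and `CompleteFiltration.eq_of_exp_eq`.

Part (c) needs that the automorphisms `e^{ad U}` form a group. The Baker–Campbell–Hausdorff formula
is avoided as follows. There is a derivation `D` acting on the degree `j` part as multiplication by
`j`. An automorphism `φ` that is the identity up to higher degree is determined by
`w = D - φ D φ⁻¹`, and if `φ = e^{ad U}` then `w` is (the inner derivation by) an element of
positive degree, by the computation of `e^{ad U} D` in the semidirect sum with `F D`. Conversely
every `w` of positive degree comes from some `U`, by solving `e^{ad U} D = D - w` degree by degree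
(`CompleteFiltration.exists_isExp_of_isTwist`). As the automorphisms with such a `w` visibly form a
group, so do the exponentials (`CompleteFiltration.exists_isExp_trans`,
`CompleteFiltration.exists_isExp_symm_trans`).

It remains to see when `σ = e^{ad W}` takes one normal form `∂ + f + z E + h(z)` to another. If
`W ∈ 𝔥`, then `σ` fixes `s`, and an element `∂ + f + z E + y` has `y ∈ 𝔥` if and only if it commutes
with `s`; hence normal forms go to normal forms (`IsReductionDatum.exp_centralizer_apply`).
Conversely, comparing `e^{ad W}` with `e^{ad S}`, where `S` is the component of `W` in `𝔥`, shows
degree by degree that `W - S` vanishes (`IsReductionDatum.mem_ker_of_exp_apply`).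
-/

noncomputable section

namespace DrinfeldSokolov

/-! ### Lie algebras with a complete filtration, and exponentials -/

section Filtration

variable {F : Type*} [Field F] {L : Type*} [LieRing L] [LieAlgebra F L]

/-- A decreasing `ℤ`-filtration of a Lie algebra by subspaces that is compatible with the bracket,
separated, exhaustive and complete. Completeness is stated for series whose `n`-th term lies in
`Fil (j + n)`, with the corresponding rate of convergence. -/
structure CompleteFiltration (Fil : ℤ → Submodule F L) : Prop where
  anti : Antitone Fil
  lie_mem : ∀ {i j : ℤ} {x y : L}, x ∈ Fil i → y ∈ Fil j → ⁅x, y⁆ ∈ Fil (i + j)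
  sep : ∀ x, (∀ j, x ∈ Fil j) → x = 0
  exh : ∀ x, ∃ j, x ∈ Fil j
  complete : ∀ (x : ℕ → L) (j : ℤ), (∀ n : ℕ, x (n + 1) - x n ∈ Fil (j + n)) →
    ∃ y, ∀ n : ℕ, y - x n ∈ Fil (j + n)

/-- The partial sum `∑_{k < n} (ad U)ᵏ / k!` of `e^{ad U}`. -/
def expPart (F : Type*) [Field F] {L : Type*} [LieRing L] [LieAlgebra F L] (U : L) (n : ℕ) :
    L →ₗ[F] L :=
  ∑ k ∈ Finset.range n, ((k.factorial : F)⁻¹) • ((LieAlgebra.ad F L U) ^ k)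

/-- The map `φ` is `e^{ad U}`, for `U` of positive degree: on `Fil j` it agrees with the `n`-th
partial sum of the exponential series up to `Fil (j + n)`. -/
def IsExp (Fil : ℤ → Submodule F L) (U : L) (φ : L → L) : Prop :=
  ∀ (j : ℤ), ∀ x ∈ Fil j, ∀ n : ℕ, φ x - expPart F U n x ∈ Fil (j + n)

variable {Fil : ℤ → Submodule F L}

namespace CompleteFiltration

variable (hF : CompleteFiltration Fil)
include hF

lemma mem_of_le {i j : ℤ} {x : L} (hx : x ∈ Fil j) (h : i ≤ j) : x ∈ Fil i := hF.anti h hx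

lemma eq_zero_of_nat (x : L) (j : ℤ) (h : ∀ n : ℕ, x ∈ Fil (j + n)) : x = 0 :=
  hF.sep x fun i => hF.mem_of_le (h (i - j).toNat) (by have := Int.self_le_toNat (i - j); lia)

lemma ad_pow_mem {U x : L} {d j : ℤ} (hU : U ∈ Fil d) (hx : x ∈ Fil j) (k : ℕ) :
    ((LieAlgebra.ad F L U) ^ k) x ∈ Fil (j + k * d) := by
  induction k with
  | zero => simpa using hx
  | succ k ih =>
    rw [pow_succ', Module.End.mul_apply, LieAlgebra.ad_apply]
    have := hF.lie_mem hU ih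
    convert this using 2
    push_cast; ring

lemma expPart_sub_mem {U x : L} {j : ℤ} (hU : U ∈ Fil 1) (hx : x ∈ Fil j) {n m : ℕ}
    (h : n ≤ m) : expPart F U m x - expPart F U n x ∈ Fil (j + n) := by
  induction m, h using Nat.le_induction with
  | base => simp
  | succ m hm ih =>
    have : expPart F U (m + 1) x - expPart F U n x
        = (expPart F U m x - expPart F U n x)
          + ((m.factorial : F)⁻¹) • ((LieAlgebra.ad F L U) ^ m) x := by
      simp [expPart, Finset.sum_range_succ]; abel
    rw [this]
    refine add_mem ih (Submodule.smul_mem _ _ ?_)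
    exact hF.mem_of_le (hF.ad_pow_mem hU hx m) (by lia)

/-- Convergence of the exponential series at `x`. A single limit `y` serves all `j` with
`x ∈ Fil j`. -/
lemma exists_exp_apply {U : L} (hU : U ∈ Fil 1) (x : L) :
    ∃ y, ∀ j, x ∈ Fil j → ∀ n : ℕ, y - expPart F U n x ∈ Fil (j + n) := by
  obtain ⟨j₀, hj₀⟩ := hF.exh x
  obtain ⟨y, hy⟩ := hF.complete (fun n => expPart F U n x) j₀
    fun n => hF.expPart_sub_mem hU hj₀ n.le_succ
  refine ⟨y, fun j hj n => ?_⟩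
  have h1 := hy (max n (j + n - j₀).toNat)
  have h2 := hF.expPart_sub_mem hU hj (le_max_left n (j + n - j₀).toNat)
  rw [← sub_add_sub_cancel]
  refine add_mem (hF.mem_of_le h1 ?_) h2
  have := Int.self_le_toNat (j + n - j₀)
  push_cast
  lia

lemma isExp_unique {U : L} {φ ψ : L → L} (hφ : IsExp Fil U φ) (hψ : IsExp Fil U ψ) (x : L) :
    φ x = ψ x := by
  obtain ⟨j, hj⟩ := hF.exh x
  rw [← sub_eq_zero]
  refine hF.eq_zero_of_nat _ j fun n => ?_
  have := sub_mem (hφ j x hj n) (hψ j x hj n)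
  rwa [sub_sub_sub_cancel_right] at this

/-- A map that differs from the identity by terms of higher degree is bijective. -/
lemma bijective_of_unipotent (φ : L →ₗ[F] L) (h : ∀ j, ∀ x ∈ Fil j, φ x - x ∈ Fil (j + 1)) :
    Function.Bijective φ := by
  have hpres : ∀ j, ∀ x ∈ Fil j, φ x ∈ Fil j := fun j x hx => by
    rw [← sub_add_cancel (φ x) x]
    exact add_mem (hF.mem_of_le (h j x hx) (by lia)) hx
  constructor
  · rw [← LinearMap.ker_eq_bot, LinearMap.ker_eq_bot']
    intro x hx
    obtain ⟨j, hj⟩ := hF.exh x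
    refine hF.eq_zero_of_nat _ j fun n => ?_
    induction n with
    | zero => simpa using hj
    | succ n ih =>
      have := h _ x ih
      rw [hx, zero_sub, neg_mem_iff] at this
      push_cast
      rwa [← add_assoc]
  · intro y
    obtain ⟨j, hj⟩ := hF.exh y
    -- successive approximation: the error `y - φ (s n)` gains one degree at every step
    let s : ℕ → L := fun n => Nat.rec 0 (fun _ x => x + (y - φ x)) n
    have hs : ∀ n, s (n + 1) = s n + (y - φ (s n)) := fun n => rfl
    have h0 : ∀ n : ℕ, y - φ (s n) ∈ Fil (j + n) := by
      intro n
      induction n with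
      | zero => simpa [s] using hj
      | succ n ih =>
        have := h _ _ ih
        rw [hs, map_add]
        rw [← neg_mem_iff]
        push_cast
        rw [← add_assoc]
        convert this using 1
        abel
    obtain ⟨x, hx⟩ := hF.complete s j fun n => by rw [hs]; simpa using h0 n
    refine ⟨x, ?_⟩
    rw [← sub_eq_zero]
    refine hF.eq_zero_of_nat _ j fun n => ?_
    have := sub_mem (hpres _ _ (hx n)) (h0 n)
    rw [map_sub] at this
    convert this using 1
    abel

variable [CharZero F]

/-- The partial sums of `e^{ad U}` are compatible with the bracket up to terms of high degree. By
the Leibniz formula the difference consists of the terms `⁅(ad U)ᵃ x / a!, (ad U)ᵇ y / b!⁆` with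
`a, b < n ≤ a + b`. -/
lemma expPart_lie_sub_mem {U x y : L} {i j : ℤ} (hU : U ∈ Fil 1) (hx : x ∈ Fil i) (hy : y ∈ Fil j)
    (n : ℕ) : expPart F U n ⁅x, y⁆ - ⁅expPart F U n x, expPart F U n y⁆ ∈ Fil (i + j + n) := by
  set A := LieAlgebra.ad F L U with hA
  let G : ℕ × ℕ → L := fun p => ⁅((p.1.factorial : F)⁻¹) • (A ^ p.1) x,
    ((p.2.factorial : F)⁻¹) • (A ^ p.2) y⁆
  have h1 : ∀ k : ℕ, ((k.factorial : F)⁻¹) • (A ^ k) ⁅x, y⁆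
      = ∑ p ∈ Finset.HasAntidiagonal.antidiagonal k, G p := by
    intro k
    have := LieDerivation.iterate_apply_lie (LieDerivation.inner F L L (-U)) k x y
    have hit : ∀ m, ∀ z : L, (LieDerivation.inner F L L (-U))^[m] z = (A ^ m) z := by
      intro m z
      rw [Module.End.pow_apply]
      have : ⇑(LieDerivation.inner F L L (-U)) = ⇑A := by
        funext a
        simp [hA]
      rw [this]
    rw [hit] at this
    rw [this, Finset.smul_sum]
    refine Finset.sum_congr rfl fun p hp => ?_
    have hp' : p.1 + p.2 = k := by simpa using hp
    rw [hit, hit, ← Nat.cast_smul_eq_nsmul F, smul_smul]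
    simp only [G, smul_lie, lie_smul, smul_smul]
    congr 1
    rw [← hp', Nat.choose_symm_add, Nat.add_choose,
      Nat.cast_div (Nat.factorial_mul_factorial_dvd_factorial_add _ _)
        (by simp [Nat.factorial_ne_zero])]
    have := Nat.factorial_ne_zero (p.1 + p.2)
    have := Nat.factorial_ne_zero p.1
    have := Nat.factorial_ne_zero p.2
    push_cast
    field_simp
  have h2 : expPart F U n ⁅x, y⁆
      = ∑ p ∈ (Finset.range n ×ˢ Finset.range n).filter (fun p => p.1 + p.2 < n), G p := by
    simp only [expPart, LinearMap.sum_apply, LinearMap.smul_apply]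
    rw [Finset.sum_congr rfl fun k _ => h1 k]
    rw [← Finset.sum_fiberwise_of_maps_to (t := Finset.range n) (g := fun p : ℕ × ℕ => p.1 + p.2)]
    · refine Finset.sum_congr rfl fun k hk => Finset.sum_congr ?_ fun _ _ => rfl
      ext ⟨a, b⟩
      simp at hk ⊢
      lia
    · intro p hp
      simp at hp ⊢
      exact hp.2
  have h3 : ⁅expPart F U n x, expPart F U n y⁆ = ∑ p ∈ Finset.range n ×ˢ Finset.range n, G p := by
    simp only [expPart, LinearMap.sum_apply, LinearMap.smul_apply]
    rw [sum_lie_sum, Finset.sum_product]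
  rw [h2, h3, ← Finset.sum_filter_add_sum_filter_not (_ ×ˢ _)
    (fun p : ℕ × ℕ => p.1 + p.2 < n) (f := G), sub_add_cancel_left]
  refine neg_mem (sum_mem fun p hp => ?_)
  simp at hp
  refine hF.mem_of_le (hF.lie_mem (Submodule.smul_mem _ _ (hF.ad_pow_mem hU hx p.1))
    (Submodule.smul_mem _ _ (hF.ad_pow_mem hU hy p.2))) ?_
  have : n ≤ p.1 + p.2 := hp.2
  lia

/-- The exponential series of an element of positive degree converges to an automorphism. -/
theorem exists_exp {U : L} (hU : U ∈ Fil 1) : ∃ φ : L ≃ₗ⁅F⁆ L, IsExp Fil U φ := by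
  choose φ hφ using fun x => hF.exists_exp_apply hU x
  have hφ' : IsExp Fil U φ := fun j x hx n => hφ x j hx n
  -- any limit of the partial sums at `x`, at whatever rate `j`, is `φ x`
  have key : ∀ x y j, (∀ n : ℕ, y - expPart F U n x ∈ Fil (j + n)) → φ x = y := by
    intro x y j h
    obtain ⟨i, hi⟩ := hF.exh x
    rw [← sub_eq_zero]
    refine hF.eq_zero_of_nat _ (min i j) fun n => ?_
    rw [← sub_sub_sub_cancel_right _ _ (expPart F U n x)]
    exact sub_mem (hF.mem_of_le (hφ x i hi n) (by have := min_le_left i j; lia))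
      (hF.mem_of_le (h n) (by have := min_le_right i j; lia))
  let φl : L →ₗ[F] L :=
    { toFun := φ
      map_add' := fun x y => by
        obtain ⟨i, hi⟩ := hF.exh x
        obtain ⟨j, hj⟩ := hF.exh y
        refine key _ _ (min i j) fun n => ?_
        rw [map_add, add_sub_add_comm]
        exact add_mem (hφ _ _ (hF.mem_of_le hi (min_le_left _ _)) n)
          (hφ _ _ (hF.mem_of_le hj (min_le_right _ _)) n)
      map_smul' := fun c x => by
        obtain ⟨i, hi⟩ := hF.exh x
        refine key _ _ i fun n => ?_
        rw [map_smul, RingHom.id_apply, ← smul_sub]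
        exact Submodule.smul_mem _ _ (hφ _ _ hi n) }
  have huni : ∀ j, ∀ x ∈ Fil j, φl x - x ∈ Fil (j + 1) := fun j x hx => by
    have := hφ x j hx 1
    simpa [expPart, φl] using this
  have hpart : ∀ j, ∀ x ∈ Fil j, ∀ n, expPart F U n x ∈ Fil j := fun j x hx n => by
    simp only [expPart, LinearMap.sum_apply, LinearMap.smul_apply]
    exact sum_mem fun k _ => Submodule.smul_mem _ _
      (hF.mem_of_le (hF.ad_pow_mem hU hx k) (by lia))
  have hlie : ∀ x y, φl ⁅x, y⁆ = ⁅φl x, φl y⁆ := fun x y => by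
    obtain ⟨i, hi⟩ := hF.exh x
    obtain ⟨j, hj⟩ := hF.exh y
    refine key _ _ (i + j) fun n => ?_
    have h1 := hF.expPart_lie_sub_mem hU hi hj n
    have h2 := hF.lie_mem (hφ x i hi n) (hφ y j hj 0)
    have h3 := hF.lie_mem (hpart i x hi n) (hφ y j hj n)
    simp only [expPart, Finset.range_zero, Finset.sum_empty, LinearMap.zero_apply, sub_zero,
      Nat.cast_zero, add_zero] at h2
    have e : ⁅φ x, φ y⁆ - expPart F U n ⁅x, y⁆ = ⁅φ x - expPart F U n x, φ y⁆
      + ⁅expPart F U n x, φ y - expPart F U n y⁆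
      - (expPart F U n ⁅x, y⁆ - ⁅expPart F U n x, expPart F U n y⁆) := by
      simp only [sub_lie, lie_sub]; abel
    change ⁅φ x, φ y⁆ - expPart F U n ⁅x, y⁆ ∈ _
    rw [e]
    refine sub_mem (add_mem (hF.mem_of_le h2 (by lia)) (hF.mem_of_le h3 (by lia))) h1
  exact ⟨LieEquiv.ofBijective { φl with map_lie' := hlie _ _ } (hF.bijective_of_unipotent φl huni),
    hφ'⟩

omit hF [CharZero F] in
lemma isExp_sub_mem {U x : L} {φ : L → L} {j : ℤ} (hφ : IsExp Fil U φ) (hx : x ∈ Fil j) :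
    φ x - x ∈ Fil (j + 1) := by
  simpa [expPart] using hφ j x hx 1

omit [CharZero F] in
/-- To first order the exponential is additive in the exponent: changing `U` by a term of degree `d`
changes `e^{ad U} X` by its bracket with `X`, up to terms of degree greater than expected. -/
lemma isExp_sub_sub_mem {U U' X : L} {φ φ' : L → L} {d s : ℤ} (hU : U ∈ Fil 1) (hU' : U' ∈ Fil 1)
    (hφ : IsExp Fil U φ) (hφ' : IsExp Fil U' φ') (hd : U' - U ∈ Fil d) (hX : X ∈ Fil s) :
    φ' X - φ X - ⁅U' - U, X⁆ ∈ Fil (s + d + 1) := by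
  have hpow : ∀ k : ℕ, ((LieAlgebra.ad F L U') ^ (k + 1)) X - ((LieAlgebra.ad F L U) ^ (k + 1)) X
      ∈ Fil (s + d + k) := by
    intro k
    induction k with
    | zero =>
      rw [zero_add, pow_one, pow_one, LieAlgebra.ad_apply, LieAlgebra.ad_apply, ← sub_lie]
      exact hF.mem_of_le (hF.lie_mem hd hX) (by simp [add_comm])
    | succ k ih =>
      rw [pow_succ' _ (k + 1), pow_succ' _ (k + 1), Module.End.mul_apply, Module.End.mul_apply,
        LieAlgebra.ad_apply, LieAlgebra.ad_apply]
      have e : ∀ a b : L, ⁅U', a⁆ - ⁅U, b⁆ = ⁅U' - U, a⁆ + ⁅U, a - b⁆ := by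
        intro a b; simp only [sub_lie, lie_sub]; abel
      rw [e]
      exact add_mem (hF.mem_of_le (hF.lie_mem hd (hF.ad_pow_mem hU' hX (k + 1)))
        (by push_cast; lia)) (hF.mem_of_le (hF.lie_mem hU ih) (by push_cast; lia))
  have hpart : ∀ n : ℕ, expPart F U' (n + 2) X - expPart F U (n + 2) X - ⁅U' - U, X⁆
      ∈ Fil (s + d + 1) := by
    intro n
    induction n with
    | zero => simp [expPart, Finset.sum_range_succ]
    | succ n ih =>
      have e : ∀ V : L, expPart F V (n + 1 + 2) X = expPart F V (n + 2) X
          + (((n + 2).factorial : F)⁻¹) • ((LieAlgebra.ad F L V) ^ (n + 1 + 1)) X := by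
        intro V
        rw [show n + 1 + 2 = n + 2 + 1 from rfl]
        simp only [expPart]
        rw [Finset.sum_range_succ, LinearMap.add_apply]
        rfl
      rw [e, e, add_sub_add_comm, ← smul_sub, add_sub_right_comm]
      exact add_mem ih (Submodule.smul_mem _ _
        (hF.mem_of_le (hpow (n + 1)) (by push_cast; lia)))
  have h1 := hφ s X hX (d.toNat + 2)
  have h2 := hφ' s X hX (d.toNat + 2)
  have h3 := hpart d.toNat
  have hle : s + d + 1 ≤ s + ((d.toNat + 2 : ℕ) : ℤ) := by
    have := Int.self_le_toNat d
    push_cast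
    lia
  have := add_mem (sub_mem (hF.mem_of_le h2 hle) (hF.mem_of_le h1 hle)) h3
  convert this using 1
  abel

/-- Solution of `e^{ad U} X = X' + H` with `U ∈ P` of positive degree and `H ∈ Q`, by successive
approximation. The hypothesis `step` solves the linearized equation in one degree, for errors in a
subspace `Y` in which all of them are known to lie; `hP` and `hQ` say that `P` and `Q` are
closed. -/
theorem exists_exp_eq {X X' : L} {s : ℤ} (P Q Y : Submodule F L)
    (hP : ∀ x, (∀ j, ∃ p ∈ P, x - p ∈ Fil j) → x ∈ P)
    (hQ : ∀ x, (∀ j, ∃ p ∈ Q, x - p ∈ Fil j) → x ∈ Q)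
    (hX : X ∈ Fil s) (hX' : X - X' ∈ Fil (s + 1))
    (hY : ∀ U ∈ P, U ∈ Fil 1 → ∀ φ : L → L, IsExp Fil U φ → φ X - X' ∈ Y) (hQY : Q ≤ Y)
    (step : ∀ d : ℤ, 1 ≤ d → ∀ y ∈ Y, y ∈ Fil (s + d) → ∃ u ∈ P, u ∈ Fil d ∧
      ∃ q ∈ Q, q ∈ Fil (s + d) ∧ y + ⁅u, X⁆ - q ∈ Fil (s + d + 1)) :
    ∃ U ∈ P, U ∈ Fil 1 ∧ ∃ H ∈ Q, H ∈ Fil (s + 1) ∧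
      ∀ φ : L → L, IsExp Fil U φ → φ X = X' + H := by
  -- a total choice of exponentials; its values outside `Fil 1` play no role
  have hex : ∀ U, ∃ φ : L → L, U ∈ Fil 1 → IsExp Fil U φ := fun U => by
    by_cases hU : U ∈ Fil 1
    · obtain ⟨φ, hφ⟩ := hF.exists_exp hU
      exact ⟨φ, fun _ => hφ⟩
    · exact ⟨id, fun h => absurd h hU⟩
  choose ex hex using hex
  -- `R n (U, H)`: the pair is a solution up to degree `s + 1 + n`
  let R : ℕ → L × L → Prop := fun n p => p.1 ∈ P ∧ p.1 ∈ Fil 1 ∧ p.2 ∈ Q ∧ p.2 ∈ Fil (s + 1) ∧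
    ex p.1 X - X' - p.2 ∈ Fil (s + 1 + n)
  have hstep : ∀ (n : ℕ) (p : L × L), ∃ p' : L × L, R n p →
      R (n + 1) p' ∧ p'.1 - p.1 ∈ Fil (1 + n) ∧ p'.2 - p.2 ∈ Fil (s + 1 + n) := by
    rintro n ⟨U, H⟩
    by_cases hR : R n (U, H)
    swap
    · exact ⟨0, fun h => absurd h hR⟩
    obtain ⟨hUP, hU, hHQ, hH, hE⟩ := hR
    obtain ⟨u, huP, hu, q, hqQ, hq, h⟩ := step (1 + n) (by lia) _
      (sub_mem (hY U hUP hU _ (hex U hU)) (hQY hHQ)) (hF.mem_of_le hE (by lia))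
    refine ⟨(U + u, H + q), fun _ => ?_⟩
    have hU' : U + u ∈ Fil 1 := add_mem hU (hF.mem_of_le hu (by lia))
    refine ⟨⟨add_mem hUP huP, hU', add_mem hHQ hqQ,
      add_mem hH (hF.mem_of_le hq (by lia)), ?_⟩, by simpa using hu, ?_⟩
    · have := hF.isExp_sub_sub_mem hU hU' (hex U hU) (hex _ hU') (d := 1 + n) (by simpa using hu) hX
      have := add_mem this h
      refine hF.mem_of_le (j := s + (1 + n) + 1) ?_ (by push_cast; lia)
      convert this using 1
      simp only [add_sub_cancel_left]
      abel
    · simpa using hF.mem_of_le hq (by lia)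
  choose g hg using hstep
  let S : ℕ → L × L := fun n => Nat.rec 0 (fun n p => g n p) n
  have hSR : ∀ n, R n (S n) := by
    intro n
    induction n with
    | zero =>
      refine ⟨zero_mem _, zero_mem _, zero_mem _, zero_mem _, ?_⟩
      have h1 := isExp_sub_mem (hex 0 (zero_mem _)) hX
      have := add_mem h1 hX'
      change ex 0 X - X' - 0 ∈ _
      convert this using 1
      · push_cast; ring_nf
      · abel
    | succ n ih => exact (hg n (S n) ih).1
  have hS1 : ∀ n : ℕ, (S (n + 1)).1 - (S n).1 ∈ Fil (1 + n) := fun n => (hg n (S n) (hSR n)).2.1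
  have hS2 : ∀ n : ℕ, (S (n + 1)).2 - (S n).2 ∈ Fil (s + 1 + n) := fun n => (hg n (S n) (hSR n)).2.2
  obtain ⟨U, hU⟩ := hF.complete (fun n => (S n).1) 1 hS1
  obtain ⟨H, hH⟩ := hF.complete (fun n => (S n).2) (s + 1) hS2
  have hU1 : U ∈ Fil 1 := by simpa [S] using hU 0
  have hle : ∀ j i : ℤ, j ≤ i + (j - i).toNat := fun j i => by
    have := Int.self_le_toNat (j - i)
    lia
  refine ⟨U, hP U fun j => ⟨_, (hSR _).1, hF.mem_of_le (hU (j - 1).toNat) (hle _ _)⟩, hU1,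
    H, hQ H fun j => ⟨_, (hSR _).2.2.1, hF.mem_of_le (hH (j - (s + 1)).toNat) (hle _ _)⟩,
    by simpa [S] using hH 0, fun φ hφ => ?_⟩
  rw [← sub_eq_zero]
  refine hF.eq_zero_of_nat _ (s + 1) fun n => ?_
  obtain ⟨-, hn1, -, -, hn⟩ := hSR n
  have h1 := hF.isExp_sub_sub_mem hn1 hU1 (hex _ hn1) hφ (hU n) hX
  have h2 := hF.lie_mem (hU n) hX
  have h3 := hH n
  have := add_mem (hF.mem_of_le h1 (by lia)) (sub_mem (add_mem (hF.mem_of_le h2 (by lia)) hn) h3)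
  convert this using 1
  abel

omit [CharZero F] in
/-- Uniqueness of `U` in `e^{ad U} X = X' + H`, given the uniqueness of the solutions of the
linearized equation in each degree. -/
theorem eq_of_exp_eq {X X' U U' H H' : L} {φ φ' : L → L} {s : ℤ} (P Q : Submodule F L)
    (hX : X ∈ Fil s)
    (step : ∀ d : ℤ, 1 ≤ d → ∀ u ∈ P, u ∈ Fil d → ∀ q ∈ Q, ⁅u, X⁆ - q ∈ Fil (s + d + 1) →
      u ∈ Fil (d + 1))
    (hUP : U ∈ P) (hU'P : U' ∈ P) (hU : U ∈ Fil 1) (hU' : U' ∈ Fil 1) (hH : H ∈ Q) (hH' : H' ∈ Q)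
    (hφ : IsExp Fil U φ) (hφ' : IsExp Fil U' φ') (h : φ X = X' + H) (h' : φ' X = X' + H') :
    U = U' := by
  have key : ∀ n : ℕ, U' - U ∈ Fil (1 + n) := by
    intro n
    induction n with
    | zero => simpa using sub_mem hU' hU
    | succ n ih =>
      have := hF.isExp_sub_sub_mem hU hU' hφ hφ' ih hX
      rw [h, h', add_sub_add_left_eq_sub] at this
      have := step _ (by lia) _ (sub_mem hU'P hUP) ih _ (sub_mem hH' hH)
        (by rw [← neg_mem_iff]; simpa using this)
      push_cast
      rwa [← add_assoc]
  exact (sub_eq_zero.1 (hF.eq_zero_of_nat _ 1 key)).symm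

end CompleteFiltration

/-! ### The filtration of a semidirect sum with a one-dimensional Lie algebra -/

section SemiDirect

open LieAlgebra

variable (Fil) (ρ : F →ₗ⁅F⁆ LieDerivation F L L)

/-- The filtration of `L ⋊ F` that extends the one of `L`, with the generator of `F` in degree
`0`. -/
def semiDirectFil (j : ℤ) : Submodule F (SemiDirectSum L F ρ) where
  carrier := {y | y.left ∈ Fil j ∧ (0 < j → y.right = 0)}
  add_mem' := fun {a b} ha hb => ⟨add_mem ha.1 hb.1, fun h => by simp [ha.2 h, hb.2 h]⟩
  zero_mem' := ⟨zero_mem _, fun _ => rfl⟩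
  smul_mem' := fun c x hx => ⟨Submodule.smul_mem _ c hx.1, fun h => by simp [hx.2 h]⟩

variable {Fil ρ}

lemma mem_semiDirectFil {j : ℤ} {y : SemiDirectSum L F ρ} :
    y ∈ semiDirectFil Fil ρ j ↔ y.left ∈ Fil j ∧ (0 < j → y.right = 0) := Iff.rfl

lemma inl_mem_semiDirectFil {j : ℤ} {x : L} :
    SemiDirectSum.inl ρ x ∈ semiDirectFil Fil ρ j ↔ x ∈ Fil j := by
  simp [mem_semiDirectFil]

lemma exists_inl_of_mem_semiDirectFil {j : ℤ} (hj : 0 < j) {y : SemiDirectSum L F ρ}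
    (hy : y ∈ semiDirectFil Fil ρ j) : ∃ x ∈ Fil j, y = SemiDirectSum.inl ρ x :=
  ⟨y.left, hy.1, by ext <;> simp [hy.2 hj]⟩

theorem CompleteFiltration.semiDirect (hF : CompleteFiltration Fil)
    (hρ : ∀ c j, ∀ x ∈ Fil j, ρ c x ∈ Fil j) : CompleteFiltration (semiDirectFil Fil ρ) where
  anti i j h x hx := ⟨hF.anti h hx.1, fun hi => hx.2 (hi.trans_le h)⟩
  lie_mem {i j x y} hx hy := by
    refine ⟨?_, fun _ => by simp [LieRing.of_associative_ring_bracket, mul_comm]⟩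
    have h1 : ∀ {i j : ℤ} {x y : SemiDirectSum L F ρ}, x ∈ semiDirectFil Fil ρ i →
        y ∈ semiDirectFil Fil ρ j → ρ x.right y.left ∈ Fil (i + j) := by
      intro i j x y hx hy
      by_cases hi : 0 < i
      · simp [hx.2 hi]
      · exact hρ _ _ _ (hF.mem_of_le hy.1 (by lia))
    exact sub_mem (add_mem (hF.lie_mem hx.1 hy.1) (h1 hx hy)) (by rw [add_comm]; exact h1 hy hx)
  sep x h := by
    ext
    · exact hF.sep _ fun j => (h j).1
    · exact (h 1).2 one_pos
  exh x := by
    obtain ⟨j, hj⟩ := hF.exh x.left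
    exact ⟨min j 0, hF.mem_of_le hj (min_le_left _ _), fun h => absurd h (by simp)⟩
  complete x j h := by
    obtain ⟨y, hy⟩ := hF.complete (fun n => (x n).left) j fun n => (h n).1
    have hc : ∀ n, (1 - j).toNat ≤ n → (x n).right = (x (1 - j).toNat).right := by
      intro n hn
      induction n, hn using Nat.le_induction with
      | base => rfl
      | succ n hn ih =>
        rw [← ih, ← sub_eq_zero]
        exact (h n).2 (by have := Int.self_le_toNat (1 - j); lia)
    refine ⟨⟨y, (x (1 - j).toNat).right⟩, fun n => ⟨hy n, fun hn => ?_⟩⟩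
    simp only [SemiDirectSum.sub_eq_mk]
    rw [hc n (by lia), sub_self]

end SemiDirect

/-! ### Exponentials form a group -/

section Euler

open LieAlgebra

/-- The action of the one-dimensional Lie algebra `F` on `L` in which `1` acts as the derivation
`D`. -/
def scalarAction (D : LieDerivation F L L) : F →ₗ⁅F⁆ LieDerivation F L L where
  toFun c := c • D
  map_add' c d := add_smul c d _
  map_smul' c d := by simp [mul_smul]
  map_lie' := by
    intro c d
    ext x
    simp [LieRing.of_associative_ring_bracket, mul_comm c d]

/-- The map `φ` is the identity up to higher degree, and `D - φ D φ⁻¹` is the inner derivation by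
the element `w` of positive degree. -/
structure IsTwist (Fil : ℤ → Submodule F L) (D : LieDerivation F L L) (w : L) (φ : L → L) :
    Prop where
  mem : w ∈ Fil 1
  sub_mem : ∀ j, ∀ x ∈ Fil j, φ x - x ∈ Fil (j + 1)
  apply_eq : ∀ x, D (φ x) = φ (D x) + ⁅w, φ x⁆

namespace CompleteFiltration

variable {D : LieDerivation F L L} (hF : CompleteFiltration Fil)
include hF

lemma map_mem_of_sub_mem {φ : L → L} (h : ∀ j, ∀ x ∈ Fil j, φ x - x ∈ Fil (j + 1)) {j : ℤ} {x : L}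
    (hx : x ∈ Fil j) : φ x ∈ Fil j := by
  rw [← sub_add_cancel (φ x) x]
  exact add_mem (hF.mem_of_le (h j x hx) (by lia)) hx

lemma symm_sub_mem {φ : L ≃ₗ⁅F⁆ L} (h : ∀ j, ∀ x ∈ Fil j, φ x - x ∈ Fil (j + 1)) :
    ∀ j, ∀ x ∈ Fil j, φ.symm x - x ∈ Fil (j + 1) := by
  intro j x hx
  obtain ⟨i, hi⟩ := hF.exh (φ.symm x)
  have key : ∀ n : ℕ, φ.symm x ∈ Fil (min (i + n) j) := by
    intro n
    induction n with
    | zero => exact hF.mem_of_le hi (by simp)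
    | succ n ih =>
      have := h _ _ ih
      rw [LieEquiv.apply_symm_apply] at this
      rw [← sub_sub_cancel x (φ.symm x)]
      exact sub_mem (hF.mem_of_le hx (min_le_right _ _)) (hF.mem_of_le this (by push_cast; lia))
  have := h _ _ (hF.mem_of_le (key (j - i).toNat) (i := j) (by
    have := Int.self_le_toNat (j - i); simp; lia))
  rw [LieEquiv.apply_symm_apply] at this
  rw [← neg_mem_iff]
  simpa using this

lemma IsTwist.trans {w v : L} {φ ψ : L ≃ₗ⁅F⁆ L} (hφ : IsTwist Fil D w φ) (hψ : IsTwist Fil D v ψ) :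
    IsTwist Fil D (ψ w + v) (φ.trans ψ) where
  mem := add_mem (hF.map_mem_of_sub_mem hψ.sub_mem hφ.mem) hψ.mem
  sub_mem j x hx := by
    rw [LieEquiv.trans_apply, ← sub_add_sub_cancel _ (φ x)]
    exact add_mem (hψ.sub_mem j _ (hF.map_mem_of_sub_mem hφ.sub_mem hx)) (hφ.sub_mem j x hx)
  apply_eq x := by
    simp only [LieEquiv.trans_apply]
    rw [hψ.apply_eq, hφ.apply_eq, map_add, LieEquiv.map_lie, add_lie]
    abel

lemma IsTwist.symm {w : L} {φ : L ≃ₗ⁅F⁆ L} (hφ : IsTwist Fil D w φ) :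
    IsTwist Fil D (-φ.symm w) φ.symm where
  mem := neg_mem (hF.map_mem_of_sub_mem (hF.symm_sub_mem hφ.sub_mem) hφ.mem)
  sub_mem := hF.symm_sub_mem hφ.sub_mem
  apply_eq x := by
    have := congrArg φ.symm (hφ.apply_eq (φ.symm x))
    simp only [LieEquiv.apply_symm_apply, LieEquiv.map_lie, map_add,
      LieEquiv.symm_apply_apply] at this
    rw [this, neg_lie]
    abel

variable [CharZero F]
  (hD : ∀ (j : ℤ), ∀ x ∈ Fil j, D x - (j : F) • x ∈ Fil (j + 1))
include hD

omit [CharZero F] in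
lemma euler_mem {j : ℤ} {x : L} (hx : x ∈ Fil j) : D x ∈ Fil j := by
  rw [← sub_add_cancel (D x) ((j : F) • x)]
  exact add_mem (hF.mem_of_le (hD j x hx) (by lia)) (Submodule.smul_mem _ _ hx)

/-- If `D` is multiplication by `j` in degree `j`, then an automorphism that is the identity up to
higher degree and commutes with `D` is the identity: if it raised degrees by exactly `m > 0`, then
`D χ - χ D` would be `m (χ - 1)` to first order. -/
lemma eq_self_of_commute {χ : L ≃ₗ⁅F⁆ L} (h : ∀ j, ∀ x ∈ Fil j, χ x - x ∈ Fil (j + 1))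
    (hc : ∀ x, D (χ x) = χ (D x)) (x : L) : χ x = x := by
  have key : ∀ (n : ℕ) (j : ℤ), ∀ x ∈ Fil j, χ x - x ∈ Fil (j + 1 + n) := by
    intro n
    induction n with
    | zero => simpa using h
    | succ n ih =>
      intro j x hx
      have h1 := ih j x hx
      have h2 := ih _ _ (hD j x hx)
      have h3 := hD _ _ h1
      have h4 := sub_mem (hF.mem_of_le h2 (i := j + 1 + n + 1) (by lia)) h3
      have e : χ (D x - (j : F) • x) - (D x - (j : F) • x) -
          (D (χ x - x) - ((j + 1 + n : ℤ) : F) • (χ x - x)) = ((n + 1 : ℕ) : F) • (χ x - x) := by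
        simp only [map_sub, hc, map_smul]
        push_cast
        module
      rw [e] at h4
      have h5 := Submodule.smul_mem _ (((n + 1 : ℕ) : F)⁻¹) h4
      rw [smul_smul, inv_mul_cancel₀ (Nat.cast_ne_zero.2 n.succ_ne_zero), one_smul] at h5
      convert h5 using 2
      push_cast; ring
  obtain ⟨j, hj⟩ := hF.exh x
  rw [← sub_eq_zero]
  exact hF.eq_zero_of_nat _ (j + 1) fun n => key n j x hj

omit [CharZero F] in
lemma euler_semiDirect : CompleteFiltration (semiDirectFil Fil (scalarAction D)) :=
  hF.semiDirect fun c _ _ hx => Submodule.smul_mem _ c (hF.euler_mem hD hx)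

omit hF hD [CharZero F] in
lemma lie_inr_inl (x : L) : ⁅SemiDirectSum.inr (scalarAction D) 1,
    SemiDirectSum.inl (scalarAction D) x⁆ = SemiDirectSum.inl (scalarAction D) (D x) := by
  simp only [SemiDirectSum.inl_eq_mk, SemiDirectSum.inr_eq_mk, SemiDirectSum.lie_eq_mk]
  simp [scalarAction]

omit hF hD [CharZero F] in
lemma inr_mem_semiDirectFil (ρ : F →ₗ⁅F⁆ LieDerivation F L L) {j : ℤ} (hj : j ≤ 0) (c : F) :
    SemiDirectSum.inr ρ c ∈ semiDirectFil Fil ρ j :=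
  ⟨zero_mem _, fun h => absurd h (by lia)⟩

omit hD [CharZero F] hF in
lemma expPart_inl (ρ : F →ₗ⁅F⁆ LieDerivation F L L) (U x : L) (n : ℕ) :
    expPart F (SemiDirectSum.inl ρ U) n (SemiDirectSum.inl ρ x)
      = SemiDirectSum.inl ρ (expPart F U n x) := by
  have hp : ∀ k, ((LieAlgebra.ad F _ (SemiDirectSum.inl ρ U)) ^ k) (SemiDirectSum.inl ρ x)
      = SemiDirectSum.inl ρ (((LieAlgebra.ad F L U) ^ k) x) := by
    intro k
    induction k with
    | zero => simp
    | succ k ih => rw [pow_succ', pow_succ', Module.End.mul_apply, Module.End.mul_apply, ih,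
        LieAlgebra.ad_apply, LieAlgebra.ad_apply, LieHom.map_lie]
  simp only [expPart, LinearMap.sum_apply, LinearMap.smul_apply, hp, map_sum, map_smul]

omit [CharZero F] in
/-- The twist of `e^{ad U}` is read off from the value of `e^{ad U}` at the derivation `D`, seen as
an element of the semidirect sum with `F D`. -/
lemma isTwist_of_isExp {U w : L} (hU : U ∈ Fil 1) {φ : L ≃ₗ⁅F⁆ L} (hφ : IsExp Fil U φ)
    {Ψ : SemiDirectSum L F (scalarAction D) ≃ₗ⁅F⁆ SemiDirectSum L F (scalarAction D)}
    (hΨ : IsExp (semiDirectFil Fil (scalarAction D)) (SemiDirectSum.inl _ U) Ψ)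
    (hw : Ψ (SemiDirectSum.inr _ 1) = SemiDirectSum.inr _ 1 - SemiDirectSum.inl _ w)
    (hw1 : w ∈ Fil 1) : IsTwist Fil D w φ := by
  have hB := hF.euler_semiDirect hD
  have hU' : SemiDirectSum.inl (scalarAction D) U ∈ semiDirectFil Fil (scalarAction D) 1 :=
    inl_mem_semiDirectFil.2 hU
  have hinl : ∀ x, Ψ (SemiDirectSum.inl _ x) = SemiDirectSum.inl _ (φ x) := by
    intro x
    obtain ⟨j, hj⟩ := hF.exh x
    rw [← sub_eq_zero]
    refine hB.eq_zero_of_nat _ j fun n => ?_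
    have h1 := hΨ j _ (inl_mem_semiDirectFil.2 hj) n
    have h2 := inl_mem_semiDirectFil (ρ := scalarAction D).2 (hφ j x hj n)
    have := sub_mem h1 h2
    rwa [expPart_inl, map_sub, sub_sub_sub_cancel_right] at this
  refine ⟨hw1, fun j x hx => isExp_sub_mem hφ hx, fun x => ?_⟩
  have := LieEquiv.map_lie Ψ (SemiDirectSum.inr _ 1) (SemiDirectSum.inl _ x)
  rw [lie_inr_inl, hinl, hw, hinl, sub_lie, lie_inr_inl, ← LieHom.map_lie, ← map_sub] at this
  have := SemiDirectSum.inl_injective _ this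
  rw [this, sub_add_cancel]

lemma exists_isTwist {U : L} (hU : U ∈ Fil 1) {φ : L ≃ₗ⁅F⁆ L} (hφ : IsExp Fil U φ) :
    ∃ w, IsTwist Fil D w φ := by
  have hB := hF.euler_semiDirect hD
  have hU' : SemiDirectSum.inl (scalarAction D) U ∈ semiDirectFil Fil (scalarAction D) 1 :=
    inl_mem_semiDirectFil.2 hU
  obtain ⟨Ψ, hΨ⟩ := hB.exists_exp hU'
  have h := isExp_sub_mem hΨ (inr_mem_semiDirectFil (scalarAction D) le_rfl 1)
  obtain ⟨w, hw, e⟩ := exists_inl_of_mem_semiDirectFil (by norm_num) h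
  refine ⟨-w, hF.isTwist_of_isExp hD hU hφ hΨ ?_ (neg_mem (by simpa using hw))⟩
  rw [map_neg, ← e]
  abel

/-- Every automorphism with a twist is an exponential. As `D` is invertible in positive degrees,
there is a `U` of positive degree such that `e^{ad U}` has the same twist `w`, and an automorphism
is determined by its twist. -/
lemma exists_isExp_of_isTwist {w : L} {φ : L ≃ₗ⁅F⁆ L} (hφ : IsTwist Fil D w φ) :
    ∃ U ∈ Fil 1, IsExp Fil U φ := by
  have hB := hF.euler_semiDirect hD
  obtain ⟨U', hU'P, hU', -, rfl, -, hexp⟩ := hB.exists_exp_eq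
    (X := SemiDirectSum.inr (scalarAction D) 1)
    (X' := SemiDirectSum.inr _ 1 - SemiDirectSum.inl _ w) (s := 0) ⊤ ⊥ ⊤
    (fun _ _ => trivial) (fun x h => by
      refine hB.sep x fun j => ?_
      obtain ⟨p, rfl, hp⟩ := h j
      simpa using hp)
    (inr_mem_semiDirectFil _ le_rfl 1)
    (by rw [sub_sub_cancel]; exact inl_mem_semiDirectFil.2 (by simpa using hφ.mem))
    (fun _ _ _ _ _ => trivial) le_top (by
      intro d hd y _ hy
      obtain ⟨x, hx, rfl⟩ := exists_inl_of_mem_semiDirectFil (by lia) hy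
      rw [zero_add] at hx ⊢
      have hd0 : (d : F) ≠ 0 := by exact_mod_cast (by lia : d ≠ 0)
      -- `⁅u, D⁆ = -D u`, which is `-d u` up to higher degree
      refine ⟨SemiDirectSum.inl _ ((d : F)⁻¹ • x), trivial,
        inl_mem_semiDirectFil.2 (Submodule.smul_mem _ _ hx), 0, rfl, zero_mem _, ?_⟩
      rw [sub_zero, ← lie_skew, lie_inr_inl, ← sub_eq_add_neg, ← map_sub, inl_mem_semiDirectFil]
      have := neg_mem (Submodule.smul_mem _ ((d : F)⁻¹) (hD d x hx))
      rw [smul_sub, smul_smul, inv_mul_cancel₀ hd0, one_smul, neg_sub] at this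
      simpa using this)
  obtain ⟨U, hU, rfl⟩ := exists_inl_of_mem_semiDirectFil (by norm_num) hU'
  obtain ⟨Ψ, hΨ⟩ := hB.exists_exp hU'
  obtain ⟨ψ, hψ⟩ := hF.exists_exp hU
  have hψt := hF.isTwist_of_isExp hD hU hψ hΨ (w := w) (by rw [hexp Ψ hΨ, add_zero]) hφ.mem
  refine ⟨U, hU, ?_⟩
  have hψs := hF.symm_sub_mem hψt.sub_mem
  have hχ : ∀ x, ψ.symm (φ x) = x := by
    refine hF.eq_self_of_commute hD (χ := φ.trans ψ.symm) (fun j x hx => ?_) fun x => ?_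
    · rw [LieEquiv.trans_apply, ← sub_add_sub_cancel _ (φ x)]
      exact add_mem (hψs j _ (hF.map_mem_of_sub_mem hφ.sub_mem hx)) (hφ.sub_mem j x hx)
    · rw [LieEquiv.trans_apply, LieEquiv.trans_apply, ← ψ.symm_apply_apply (D _)]
      congr 1
      have := hψt.apply_eq (ψ.symm (φ x))
      rw [ψ.apply_symm_apply, hφ.apply_eq] at this
      exact (add_right_cancel this).symm
  have : (φ : L → L) = ψ := funext fun x => by rw [← hχ x, ψ.apply_symm_apply, hχ x]
  rwa [this]

/-- Products of exponentials are exponentials. -/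
theorem exists_isExp_trans {U V : L} {φ ψ : L ≃ₗ⁅F⁆ L} (hU : U ∈ Fil 1) (hV : V ∈ Fil 1)
    (hφ : IsExp Fil U φ) (hψ : IsExp Fil V ψ) : ∃ W ∈ Fil 1, IsExp Fil W (φ.trans ψ) := by
  obtain ⟨w, hw⟩ := hF.exists_isTwist hD hU hφ
  obtain ⟨v, hv⟩ := hF.exists_isTwist hD hV hψ
  exact hF.exists_isExp_of_isTwist hD (IsTwist.trans hF hw hv)

theorem exists_isExp_symm_trans {U V : L} {φ ψ : L ≃ₗ⁅F⁆ L} (hU : U ∈ Fil 1) (hV : V ∈ Fil 1)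
    (hφ : IsExp Fil U φ) (hψ : IsExp Fil V ψ) : ∃ W ∈ Fil 1, IsExp Fil W (φ.symm.trans ψ) := by
  obtain ⟨w, hw⟩ := hF.exists_isTwist hD hU hφ
  obtain ⟨v, hv⟩ := hF.exists_isTwist hD hV hψ
  exact hF.exists_isExp_of_isTwist hD (IsTwist.trans hF (IsTwist.symm hF hw) hv)

end CompleteFiltration
end Euler
end Filtration

/-! ### Integrality of the weights of an `sl₂`-triple -/

section Sl2

variable {F : Type*} [Field F] [CharZero F] {V : Type*} [AddCommGroup V] [Module F V]
  [FiniteDimensional F V]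

/-- An operator `e` with `[h, e] = c e`, `c ≠ 0`, is nilpotent: its non-zero powers would be
eigenvectors of `[h, ·]` for infinitely many eigenvalues. -/
theorem isNilpotent_of_shift {h e : Module.End F V} {c : F} (hc : c ≠ 0)
    (he : ∀ v, h (e v) = e (h v) + c • e v) : IsNilpotent e := by
  by_contra hn
  have hne : ∀ k, e ^ k ≠ 0 := fun k hk => hn ⟨k, hk⟩
  let T : Module.End F (Module.End F V) := LinearMap.mulLeft F h - LinearMap.mulRight F h
  have hT : ∀ k : ℕ, T (e ^ k) = ((k : F) * c) • e ^ k := by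
    intro k
    have key : ∀ v, h ((e ^ k) v) = (e ^ k) (h v) + ((k : F) * c) • (e ^ k) v := by
      induction k with
      | zero => simp
      | succ k ih =>
        intro v
        rw [pow_succ', Module.End.mul_apply, Module.End.mul_apply, he, ih, map_add, map_smul]
        push_cast
        module
    ext v
    simp [T, key]
  have := Module.End.eigenvectors_linearIndependent' T (fun k : ℕ => (k : F) * c)
    (fun a b hab => by simpa [hc] using hab) (fun k => e ^ k)
    (fun k => ⟨Module.End.mem_eigenspace_iff.2 (hT k), hne k⟩)
  exact not_finite_iff_infinite.2 inferInstance (this.finite (R := F))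

variable {e h f : Module.End F V}

section String

variable (hef : ∀ v, e (f v) = f (e v) + h v) (hhf : ∀ v, h (f v) = f (h v) - (2 : F) • f v)
include hef hhf

omit [CharZero F] [FiniteDimensional F V] in
/-- The action of `e` on the string `fᵐ w` below a vector `w` with `e w = 0`, where `w` is an
eigenvector of `h` up to an error `s`. -/
lemma string_apply {w s : V} {μ : F} (hw : e w = 0) (hhw : h w = μ • w + s)
    (m : ℕ) : e ((f ^ (m + 1)) w)
      = ((m + 1 : F) * (μ - m)) • (f ^ m) w + (m + 1 : F) • (f ^ m) s := by
  have hh : ∀ m : ℕ, h ((f ^ m) w) = (μ - 2 * m) • (f ^ m) w + (f ^ m) s := by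
    intro m
    induction m with
    | zero => simp [hhw]
    | succ m ih =>
      rw [pow_succ', Module.End.mul_apply, Module.End.mul_apply, hhf, ih, map_add, map_smul]
      push_cast
      module
  induction m with
  | zero => simp [hef, hw, hhw]
  | succ m ih =>
    rw [pow_succ', Module.End.mul_apply, hef, ih, hh, map_add, map_smul, map_smul,
      pow_succ' f m, Module.End.mul_apply, Module.End.mul_apply]
    push_cast
    module

omit [FiniteDimensional F V] in
/-- A highest weight is a natural number, and the weight space is not the start of a Jordan block of
`h`: a vector `w` with `e w = 0` and `h w = μ w + s`, for a highest weight vector `s`, would give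
`e (fⁿ⁺¹ w) = (n + 1) fⁿ s ≠ 0`, whereas `fⁿ⁺¹ w = 0`. -/
lemma exists_nat_and_eq_zero (hf : IsNilpotent f) {s : V} {μ : F} (hs : e s = 0)
    (hhs : h s = μ • s) (hs0 : s ≠ 0) :
    (∃ n : ℕ, μ = n) ∧ ∀ w, e w = 0 → h w ≠ μ • w + s := by
  obtain ⟨N, hN⟩ := hf
  obtain ⟨n, hn, hn'⟩ : ∃ n, (f ^ n) s ≠ 0 ∧ (f ^ (n + 1)) s = 0 :=
    Nat.exists_not_and_succ_of_not_zero_of_exists (p := fun n => (f ^ n) s = 0) (by simpa using hs0)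
      ⟨N, by simp [hN]⟩
  have h1 := string_apply (s := 0) (μ := μ) hef hhf hs (by simpa using hhs) n
  have hcast : ∀ m : ℕ, (m + 1 : F) ≠ 0 := fun m => Nat.cast_add_one_ne_zero m
  rw [hn', map_zero, map_zero, smul_zero, add_zero, eq_comm, smul_eq_zero] at h1
  have hμ : μ = n := by
    simpa [hcast, hn, sub_eq_zero] using h1
  refine ⟨⟨n, hμ⟩, fun w hw hhw => ?_⟩
  have hsz : ∀ m, n + 1 ≤ m → (f ^ m) s = 0 := by
    intro m hm
    obtain ⟨k, rfl⟩ := Nat.exists_eq_add_of_le' hm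
    rw [pow_add, Module.End.mul_apply, hn', map_zero]
  have hdown : ∀ k m, n + 1 ≤ m → (f ^ (m + k)) w = 0 → (f ^ m) w = 0 := by
    intro k
    induction k with
    | zero => simp
    | succ k ih =>
      intro m hm hk
      have h2 := string_apply hef hhf hw hhw m
      rw [ih (m + 1) (by lia) (by rwa [add_right_comm, add_assoc]), hsz m hm, map_zero, smul_zero,
        add_zero, eq_comm, smul_eq_zero, hμ] at h2
      refine h2.resolve_left (mul_ne_zero (hcast m) (sub_ne_zero.2 ?_))
      exact_mod_cast (by lia : n ≠ m)
  have h3 := string_apply hef hhf hw hhw n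
  rw [hdown N (n + 1) le_rfl (by rw [pow_add, hN, mul_zero, LinearMap.zero_apply]), hμ, map_zero,
    sub_self, mul_zero, zero_smul, zero_add, eq_comm, smul_eq_zero] at h3
  exact h3.elim (hcast n) hn

variable (hhe : ∀ v, h (e v) = e (h v) + (2 : F) • e v)
include hhe

omit [FiniteDimensional F V] [CharZero F] hhf in
/-- The eigenvalues of `e f` on the weight spaces of positive weight are positive integers. The
proof ascends along `t, e t, e² t, …` to a highest weight vector. -/
lemma exists_pos_eigenvalue (k : ℕ) : ∀ {t : V} {c : F} {m : ℕ}, 1 ≤ m → (e ^ k) t = 0 → t ≠ 0 →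
    h t = (m : F) • t → e (f t) = c • t → ∃ n : ℕ, 0 < n ∧ c = n := by
  induction k with
  | zero => intro t c m _ h0 ht; exact absurd (by simpa using h0) ht
  | succ k ih =>
    intro t c m hm hk ht hht hc
    by_cases h0 : e t = 0
    · rw [hef, h0, map_zero, zero_add, hht] at hc
      exact ⟨m, hm, (smul_left_injective F ht hc).symm⟩
    · obtain ⟨n, hn, hn'⟩ := ih (t := e t) (c := c - m) (m := m + 2) (by lia)
        (by rwa [← Module.End.mul_apply, ← pow_succ]) h0
        (by rw [hhe, hht, map_smul]; push_cast; module)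
        (by
          have : f (e t) = c • t - (m : F) • t := by rw [← hc, hef, hht]; abel
          rw [this, map_sub, map_smul, map_smul, sub_smul])
      exact ⟨n + m, by lia, by push_cast; rw [← hn']; ring⟩

/-- On weight vectors of positive weight `m`, the operator `e` has preimages of weight `m - 2`. -/
lemma exists_preimage (he : IsNilpotent e) {t : V} {m : ℕ} (hm : 1 ≤ m) (hht : h t = (m : F) • t) :
    ∃ u, e u = t ∧ h u = ((m : F) - 2) • u := by
  obtain ⟨N, hN⟩ := he
  -- `e f` is injective, hence bijective, on the weight space
  let X := h.eigenspace (m : F)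
  have hX : ∀ x ∈ X, (e * f) x ∈ X := by
    intro x hx
    rw [Module.End.mem_eigenspace_iff] at hx ⊢
    rw [Module.End.mul_apply, hhe, hhf, hx, map_sub, map_smul, map_smul, map_smul]
    module
  have hinj : Function.Injective ((e * f).restrict hX) := by
    rw [← LinearMap.ker_eq_bot, LinearMap.ker_eq_bot']
    rintro ⟨x, hx⟩ h0
    by_contra hne
    have h0' : e (f x) = (0 : F) • x := by simpa using congrArg Subtype.val h0
    obtain ⟨n, hn, hn'⟩ := exists_pos_eigenvalue hef hhe N hm (by simp [hN])
      (fun h => hne (Subtype.ext h)) (Module.End.mem_eigenspace_iff.1 hx) h0'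
    exact hn.ne (by exact_mod_cast hn')
  obtain ⟨⟨x, hx⟩, hxt⟩ := LinearMap.surjective_of_injective hinj
    ⟨t, Module.End.mem_eigenspace_iff.2 hht⟩
  refine ⟨f x, congrArg Subtype.val hxt, ?_⟩
  rw [hhf, Module.End.mem_eigenspace_iff.1 hx, map_smul, sub_smul]

omit [FiniteDimensional F V] in
/-- Generalized weight vectors killed by `e` are weight vectors, with a natural number as weight. -/
lemma eigen_of_ker (hf : IsNilpotent f) {μ : F} {v : V} (hv : e v = 0)
    (hg : v ∈ h.maxGenEigenspace μ) :
    h v = μ • v ∧ (v ≠ 0 → ∃ n : ℕ, μ = n) := by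
  obtain ⟨N, hN⟩ := Module.End.mem_maxGenEigenspace _ _ _ |>.1 hg
  have hcom : ∀ x, e x = 0 → e ((h - μ • 1) x) = 0 := by
    intro x hx
    have := hhe x
    rw [hx] at this
    simp only [LinearMap.sub_apply, LinearMap.smul_apply, Module.End.one_apply, map_sub, map_smul,
      hx]
    simpa using this.symm
  induction N generalizing v with
  | zero =>
    have : v = 0 := by simpa using hN
    simp [this]
  | succ N ih =>
    have hN' := hN
    rw [pow_succ, Module.End.mul_apply] at hN'
    obtain ⟨h1, h2⟩ := ih (v := (h - μ • 1) v) (hcom v hv)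
      ((Module.End.mem_maxGenEigenspace _ _ _).2 ⟨N, hN'⟩) hN'
    have h0 : (h - μ • 1) v = 0 := by
      by_contra hne
      refine (exists_nat_and_eq_zero hef hhf hf (hcom v hv) h1 hne).2 v hv ?_
      simp
    have h3 : h v = μ • v := by simpa [sub_eq_zero] using h0
    exact ⟨h3, fun hne => (exists_nat_and_eq_zero hef hhf hf hv h3 hne).1⟩

/-- Generalized weight vectors are weight vectors of integral weight. The induction is on the power
of `e` that kills `v`: if `e v` is a weight vector, then `v` is corrected by a weight vector with
the same image under `e`, which reduces the claim to `eigen_of_ker`. -/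
lemma eigen_of_mem_maxGenEigenspace (he : IsNilpotent e) (hf : IsNilpotent f) (k : ℕ) :
    ∀ {μ : F} {v : V}, (e ^ k) v = 0 → v ∈ h.maxGenEigenspace μ →
      h v = μ • v ∧ (v ≠ 0 → ∃ n : ℤ, μ = n) := by
  induction k with
  | zero => intro μ v hv; have : v = 0 := by simpa using hv
            simp [this]
  | succ k ih =>
    intro μ v hk hv
    by_cases h0 : e v = 0
    · obtain ⟨h1, h2⟩ := eigen_of_ker hef hhf hhe hf h0 hv
      exact ⟨h1, fun hne => by obtain ⟨n, hn⟩ := h2 hne; exact ⟨n, by simpa using hn⟩⟩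
    have hshift : ∀ (n : ℕ) (x : V), ((h - (μ + 2) • 1) ^ n) (e x) = e (((h - μ • 1) ^ n) x) := by
      intro n
      induction n with
      | zero => simp
      | succ n ihn =>
        intro x
        rw [pow_succ, Module.End.mul_apply, pow_succ, Module.End.mul_apply, ← ihn]
        congr 1
        simp only [LinearMap.sub_apply, LinearMap.smul_apply, Module.End.one_apply, map_sub,
          map_smul, hhe]
        module
    obtain ⟨N, hN⟩ := (Module.End.mem_maxGenEigenspace _ _ _).1 hv
    obtain ⟨h1, h2⟩ := ih (μ := μ + 2) (v := e v) (by rwa [← Module.End.mul_apply, ← pow_succ])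
      ((Module.End.mem_maxGenEigenspace _ _ _).2 ⟨N, by rw [hshift, hN, map_zero]⟩)
    obtain ⟨n, hn⟩ := h2 h0
    refine ⟨?_, fun _ => ⟨n - 2, by push_cast; rw [← hn]; ring⟩⟩
    have hes : e ((h - μ • 1) v) = 0 := by
      have := hshift 1 v
      rw [pow_one, pow_one] at this
      rw [← this]
      simp [h1]
    by_contra hne
    have hne' : (h - μ • 1) v ≠ 0 := by simpa [sub_eq_zero] using hne
    have hgs : (h - μ • 1) v ∈ h.maxGenEigenspace μ := by
      refine (Module.End.mem_maxGenEigenspace _ _ _).2 ⟨N, ?_⟩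
      rw [← Module.End.mul_apply, ← pow_succ, pow_succ', Module.End.mul_apply, hN, map_zero]
    obtain ⟨m, hm⟩ := (eigen_of_ker hef hhf hhe hf hes hgs).2 hne'
    obtain ⟨u, hu, hu'⟩ := exists_preimage hef hhf hhe he (t := e v) (m := m + 2) (by lia)
      (by rw [h1, hm]; push_cast; rfl)
    have hu'' : h u = μ • u := by rw [hu', hm]; push_cast; module
    have hgu : u ∈ h.maxGenEigenspace μ :=
      (Module.End.mem_maxGenEigenspace _ _ _).2 ⟨1, by simp [hu'']⟩
    have h3 := (eigen_of_ker hef hhf hhe hf (v := v - u) (by simp [hu]) (sub_mem hv hgu)).1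
    apply hne
    rw [map_sub, hu'', smul_sub] at h3
    exact sub_left_injective h3

/-- The element `h` of an `sl₂`-triple of operators is diagonalizable with integral eigenvalues. -/
theorem iSup_eigenspace_int_eq_top [IsAlgClosed F] : ⨆ j : ℤ, h.eigenspace (j : F) = ⊤ := by
  have he : IsNilpotent e := isNilpotent_of_shift two_ne_zero hhe
  have hf : IsNilpotent f := isNilpotent_of_shift (h := h) (c := -2) (by norm_num)
    fun v => by rw [hhf]; module
  obtain ⟨N, hN⟩ := id he
  rw [eq_top_iff, ← Module.End.iSup_maxGenEigenspace_eq_top h]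
  refine iSup_le fun μ v hv => ?_
  by_cases hv0 : v = 0
  · simp [hv0]
  obtain ⟨h1, h2⟩ := eigen_of_mem_maxGenEigenspace hef hhf hhe he hf N (by simp [hN]) hv
  obtain ⟨n, rfl⟩ := h2 hv0
  exact Submodule.mem_iSup_of_mem n (Module.End.mem_eigenspace_iff.2 h1)

end String
end Sl2

/-! ### The grading of a Lie algebra by an `sl₂`-triple -/

section Grade

variable {F : Type*} [Field F] {g : Type*} [LieRing g] [LieAlgebra F g]

lemma mem_grade {h x : g} {j : ℤ} : x ∈ grade F h j ↔ ⁅h, x⁆ = (j : F) • x := Iff.rfl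

lemma lie_mem_grade {h x y : g} {i j : ℤ} (hx : x ∈ grade F h i) (hy : y ∈ grade F h j) :
    ⁅x, y⁆ ∈ grade F h (i + j) := by
  rw [mem_grade] at *
  rw [leibniz_lie, hx, hy, smul_lie, lie_smul, ← add_smul]
  push_cast; rfl

theorem iSup_grade_eq_top [CharZero F] [IsAlgClosed F] [FiniteDimensional F g] {e h f : g}
    (hs : IsSl2Triple h e f) : ⨆ j : ℤ, grade F h j = ⊤ := by
  have := iSup_eigenspace_int_eq_top (e := LieAlgebra.ad F g e) (h := LieAlgebra.ad F g h)
    (f := LieAlgebra.ad F g f)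
    (fun v => by simp only [LieAlgebra.ad_apply]; rw [leibniz_lie, hs.lie_e_f, add_comm])
    (fun v => by
      simp only [LieAlgebra.ad_apply]
      rw [leibniz_lie, hs.lie_lie_smul_f F, neg_lie, smul_lie]; abel)
    (fun v => by
      simp only [LieAlgebra.ad_apply]
      rw [leibniz_lie, hs.lie_h_e_smul F, smul_lie]; abel)
  rw [← this]
  congr 1
  ext j x
  rw [Module.End.mem_eigenspace_iff]
  rfl

theorem exists_basis_mem_grade [CharZero F] [IsAlgClosed F] [FiniteDimensional F g] {e h f : g}
    (hs : IsSl2Triple h e f) :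
    ∃ (b : Module.Basis (Fin (Module.finrank F g)) F g) (d : Fin (Module.finrank F g) → ℤ),
      ∀ i, b i ∈ grade F h (d i) := by
  have hspan : ⊤ ≤ Submodule.span F (⋃ j : ℤ, (grade F h j : Set g)) := by
    rw [Submodule.span_iUnion]
    simp [iSup_grade_eq_top hs]
  let b := Module.Basis.ofSpan hspan
  have : Fintype ((linearIndepOn_empty F id).extend
    (Set.empty_subset (⋃ j : ℤ, (grade F h j : Set g)))) := FiniteDimensional.fintypeBasisIndex b
  have hb : ∀ i, ∃ j, b i ∈ grade F h j := fun i => by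
    exact Set.mem_iUnion.1 (Module.Basis.ofSpan_subset hspan (Set.mem_range_self i))
  choose d hd using hb
  let σ := Fintype.equivFinOfCardEq (Module.finrank_eq_card_basis b).symm
  exact ⟨b.reindex σ, fun i => d (σ.symm i), fun i => by simpa using hd (σ.symm i)⟩

end Grade

/-! ### Extension of derivations to a semidirect sum -/

section ExtendDerivation

open LieAlgebra

variable {F : Type*} [Field F] {L : Type*} [LieRing L] [LieAlgebra F L]

/-- The extension by `0` of a derivation `D` of `L` to the semidirect sum `L ⋊ F`, if `D` commutes
with the action of `F`. -/
def extendDerivation (ρ : F →ₗ⁅F⁆ LieDerivation F L L) (D : LieDerivation F L L)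
    (hc : ∀ c x, D (ρ c x) = ρ c (D x)) :
    LieDerivation F (SemiDirectSum L F ρ) (SemiDirectSum L F ρ) where
  toFun y := ⟨D y.left, 0⟩
  map_add' x y := by simp
  map_smul' c x := by simp
  leibniz' x y := by
    simp only [LinearMap.coe_mk, AddHom.coe_mk, SemiDirectSum.lie_eq_mk, SemiDirectSum.sub_eq_mk,
      map_add, map_sub, hc, LieDerivation.apply_lie_eq_sub, map_zero, LieDerivation.zero_apply,
      lie_zero, sub_zero]
    congr 1
    abel

lemma extendDerivation_sub_mem {Fil : ℤ → Submodule F L} {ρ : F →ₗ⁅F⁆ LieDerivation F L L}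
    {D : LieDerivation F L L} (hc : ∀ c x, D (ρ c x) = ρ c (D x))
    (hD : ∀ (j : ℤ), ∀ x ∈ Fil j, D x - (j : F) • x ∈ Fil (j + 1)) (j : ℤ)
    (y : SemiDirectSum L F ρ) (hy : y ∈ semiDirectFil Fil ρ j) :
    extendDerivation ρ D hc y - (j : F) • y ∈ semiDirectFil Fil ρ (j + 1) := by
  refine ⟨hD j _ hy.1, fun hj => ?_⟩
  change 0 - (j : F) • y.right = 0
  rcases (show 0 ≤ j by lia).eq_or_lt with rfl | h
  · simp
  · simp [hy.2 h]

end ExtendDerivation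

/-! ### Coordinates in a homogeneous basis -/

section Coordinates

variable {F : Type*} [Field F] {A : Type*} [CommRing A] [Algebra F A]
  {g : Type*} [LieRing g] [LieAlgebra F g]
variable {ν : Type*} [Fintype ν] [DecidableEq ν] (b : Module.Basis ν F g)

/-- The `i`-th coordinate `M ⊗ g → M` with respect to a basis of `g`. -/
def coordT {M : Type*} [AddCommGroup M] [Module F M] (i : ν) : M ⊗[F] g →ₗ[F] M :=
  Finsupp.lapply i ∘ₗ (TensorProduct.equivFinsuppOfBasisRight (M := M) b).toLinearMap

section

variable {M : Type*} [AddCommGroup M] [Module F M]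

omit [Fintype ν] in
@[simp] lemma coordT_tmul (i : ν) (m : M) (x : g) : coordT b i (m ⊗ₜ[F] x) = b.repr x i • m := by
  simp [coordT]

omit [Fintype ν] in
lemma coordT_rTensor {M' : Type*} [AddCommGroup M'] [Module F M'] (φ : M →ₗ[F] M') (i : ν)
    (y : M ⊗[F] g) : coordT b i (φ.rTensor g y) = φ (coordT b i y) := by
  induction y using TensorProduct.induction_on with
  | zero => simp
  | add x y hx hy => simp only [map_add, hx, hy]
  | tmul s x => simp

lemma sum_coordT (y : M ⊗[F] g) : ∑ i, coordT b i y ⊗ₜ[F] b i = y := by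
  have := (TensorProduct.equivFinsuppOfBasisRight (M := M) b).symm_apply_apply y
  rw [TensorProduct.equivFinsuppOfBasisRight_symm_apply, Finsupp.sum_fintype _ _ (by simp)] at this
  exact this

lemma coordT_sum (s : ν → M) (i : ν) : coordT b i (∑ k, s k ⊗ₜ[F] b k) = s i := by
  simp [Finsupp.single_apply]

end

omit [Fintype ν] in
lemma coordT_loopCoeff (i : ν) (n : ℤ) (y : Loop F A g) :
    coordT b i (loopCoeff n y) = (coordT b i y).coeff n := by
  induction y using TensorProduct.induction_on with
  | zero => simp
  | add x y hx hy => simp [hx, hy]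
  | tmul s x => simp [loopCoeff]

variable {h : g} {d : ν → ℤ} (hb : ∀ i, b i ∈ grade F h (d i))
include hb

section

variable [CharZero F]

omit [Fintype ν] [DecidableEq ν] in
lemma repr_eq_zero_of_mem_grade [Finite ν] {x : g} {j : ℤ} (hx : x ∈ grade F h j) {i : ν}
    (hi : d i ≠ j) : b.repr x i = 0 := by
  have := Fintype.ofFinite ν
  rw [mem_grade, ← b.sum_repr x, lie_sum] at hx
  have h1 := congrArg (fun y => b.repr y i) hx
  classical
  have h2 : ∀ k, ⁅h, b k⁆ = (d k : F) • b k := hb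
  simp only [lie_smul, h2, map_sum, map_smul, Finsupp.coe_finsetSum, Finset.sum_apply,
    Finsupp.smul_apply, Module.Basis.repr_self, Finsupp.single_apply, smul_eq_mul, mul_ite, mul_one,
    mul_zero, Finset.sum_ite_eq', Finset.mem_univ, if_true] at h1
  have h3 : ((j : F) - d i) * b.repr x i = 0 := by rw [sub_mul, ← h1]; ring
  refine (mul_eq_zero.1 h3).resolve_left (sub_ne_zero.2 ?_)
  exact_mod_cast hi.symm

omit [Fintype ν] [DecidableEq ν] in
lemma repr_eq_zero_of_mem_gradeSum [Finite ν] {x : g} {S : Set ℤ} (hx : x ∈ gradeSum F h S) {i : ν}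
    (hi : d i ∉ S) : b.repr x i = 0 := by
  have : gradeSum F h S ≤ LinearMap.ker (b.coord i) :=
    iSup₂_le fun j hj y hy => repr_eq_zero_of_mem_grade b hb hy fun h => hi (h ▸ hj)
  exact this hx

lemma mem_baseChange_gradeSum {S : Set ℤ} {t : A ⊗[F] g} :
    t ∈ (gradeSum F h S).baseChange A ↔ ∀ i, d i ∉ S → coordT b i t = 0 := by
  constructor
  · intro ht i hi
    rw [Submodule.baseChange_eq_span] at ht
    induction ht using Submodule.span_induction with
    | mem x hx =>
      obtain ⟨y, hy, rfl⟩ := hx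
      change coordT b i ((1 : A) ⊗ₜ[F] y) = 0
      rw [coordT_tmul, repr_eq_zero_of_mem_gradeSum b hb hy hi, zero_smul]
    | zero => simp
    | add x y _ _ hx hy => rw [map_add, hx, hy, add_zero]
    | smul a x _ hx =>
      have : coordT b i (a • x) = a * coordT b i x := by
        clear hx ‹x ∈ _›
        induction x using TensorProduct.induction_on with
        | zero => simp
        | add x y hx hy => simp [hx, hy, mul_add]
        | tmul s x => simp [TensorProduct.smul_tmul']
      rw [this, hx, mul_zero]
  · intro ht
    rw [← sum_coordT b t]
    refine sum_mem fun i _ => ?_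
    by_cases hi : d i ∈ S
    · exact Submodule.tmul_mem_baseChange_of_mem _ (Submodule.mem_iSup_of_mem (d i)
        (Submodule.mem_iSup_of_mem hi (hb i)))
    · simp [ht i hi]

/-- In coordinates, `loopGT` consists of the series whose monomials `z⁻ⁿ ⊗ b i` have (doubled)
degree `n (κ + 2) + d i` greater than `j`. -/
lemma mem_loopGT {κ j : ℤ} {y : Loop F A g} :
    y ∈ loopGT F A h κ j ↔ ∀ i n, (coordT b i y).coeff n ≠ 0 → j < n * (κ + 2) + d i := by
  simp only [loopGT, Submodule.mem_iInf, Submodule.mem_comap, Submodule.restrictScalars_mem]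
  rw [forall_comm]
  refine forall_congr' fun n => ?_
  rw [mem_baseChange_gradeSum b hb]
  refine forall_congr' fun i => ?_
  rw [coordT_loopCoeff, ← not_imp_not, Set.mem_Ioi, not_not, sub_lt_iff_lt_add']

end

omit hb b [Fintype ν] [DecidableEq ν] in
lemma tmul_mem_loopGT {κ j e : ℤ} {s : LaurentSeries A} {x : g} (hx : x ∈ grade F h e)
    (hs : ∀ n, s.coeff n ≠ 0 → j < n * (κ + 2) + e) : s ⊗ₜ[F] x ∈ loopGT F A h κ j := by
  simp only [loopGT, Submodule.mem_iInf, Submodule.mem_comap, Submodule.restrictScalars_mem]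
  intro n
  change s.coeff n ⊗ₜ[F] x ∈ _
  by_cases h0 : s.coeff n = 0
  · rw [h0, TensorProduct.zero_tmul]; exact zero_mem _
  · exact Submodule.tmul_mem_baseChange_of_mem _ (Submodule.mem_iSup_of_mem e
      (Submodule.mem_iSup_of_mem (by have := hs n h0; simp only [Set.mem_Ioi]; lia) hx))

end Coordinates

/-! ### Completeness of the degree filtration -/

section LoopFiltration

variable (F : Type*) [Field F] (A : Type*) [CommRing A] [Algebra F A]
  {g : Type*} [LieRing g] [LieAlgebra F g]

/-- The (doubled) degree filtration of `A((z⁻¹)) ⊗ g`: the elements of degree at least `j / 2`. -/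
def loopFil (h : g) (κ : ℤ) (j : ℤ) : Submodule F (Loop F A g) := loopGT F A h κ (j - 1)

variable {F A}
variable {ν : Type*} [Fintype ν] [DecidableEq ν] (b : Module.Basis ν F g)
variable {h : g} {d : ν → ℤ} (hb : ∀ i, b i ∈ grade F h (d i)) {κ : ℤ}
variable [CharZero F]
include hb

lemma mem_loopFil {j : ℤ} {y : Loop F A g} :
    y ∈ loopFil F A h κ j ↔ ∀ i n, (coordT b i y).coeff n ≠ 0 → j ≤ n * (κ + 2) + d i := by
  rw [loopFil, mem_loopGT b hb]
  simp only [Int.sub_one_lt_iff]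

omit hb b [Fintype ν] [DecidableEq ν] [CharZero F] in
lemma tmul_mem_loopFil {j e : ℤ} {s : LaurentSeries A} {x : g} (hx : x ∈ grade F h e)
    (hs : ∀ n, s.coeff n ≠ 0 → j ≤ n * (κ + 2) + e) : s ⊗ₜ[F] x ∈ loopFil F A h κ j :=
  tmul_mem_loopGT hx fun n hn => by have := hs n hn; lia

omit hb b [Fintype ν] [DecidableEq ν] [CharZero F] in
lemma exists_coeff_eq_zero (s : LaurentSeries A) : ∃ N : ℤ, ∀ n < N, s.coeff n = 0 := by
  by_cases hs : s = 0
  · exact ⟨0, fun n _ => by simp [hs]⟩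
  · exact ⟨s.order, fun n hn => HahnSeries.coeff_eq_zero_of_lt_order hn⟩

/-- The degree filtration is complete. Since `κ + 2 > 0`, each coefficient of a Cauchy sequence is
eventually constant. -/
theorem loopFil_complete (hκ : 0 < κ + 2) : CompleteFiltration (loopFil F A h κ) where
  anti i j hij x hx := by
    rw [mem_loopFil b hb] at hx ⊢
    exact fun k n hn => hij.trans (hx k n hn)
  lie_mem {i j x y} hx hy := by
    rw [mem_loopFil b hb] at hx hy
    rw [← sum_coordT b x, ← sum_coordT b y, sum_lie_sum]
    refine sum_mem fun k _ => sum_mem fun l _ => ?_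
    rw [LieAlgebra.ExtendScalars.bracket_tmul]
    refine tmul_mem_loopFil (lie_mem_grade (hb k) (hb l)) fun n hn => ?_
    rw [HahnSeries.coeff_mul] at hn
    obtain ⟨p, hp, hne⟩ := Finset.exists_ne_zero_of_sum_ne_zero hn
    have hp' := (Finset.mem_antidiagonal.1 hp).2.2
    have h1 := hx k p.1 (left_ne_zero_of_mul hne)
    have h2 := hy l p.2 (right_ne_zero_of_mul hne)
    rw [← hp', add_mul]
    lia
  sep x hx := by
    rw [← sum_coordT b x]
    refine Finset.sum_eq_zero fun i _ => ?_
    have : coordT b i x = 0 := by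
      ext n
      by_contra hne
      have := (mem_loopFil b hb).1 (hx (n * (κ + 2) + d i + 1)) i n hne
      lia
    rw [this, TensorProduct.zero_tmul]
  exh x := by
    choose N hN using fun i => exists_coeff_eq_zero (coordT b i x)
    obtain ⟨j, hj⟩ := (Set.finite_range fun i => N i * (κ + 2) + d i).bddBelow
    refine ⟨j, (mem_loopFil b hb).2 fun i n hn => ?_⟩
    have h1 : N i ≤ n := by
      by_contra hlt
      exact hn (hN i n (by lia))
    have h2 : j ≤ N i * (κ + 2) + d i := hj ⟨i, rfl⟩
    have h3 := mul_le_mul_of_nonneg_right h1 hκ.le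
    lia
  complete x j hx := by
    have hx' := fun n => (mem_loopFil b hb).1 (hx n)
    -- the coefficient of `z⁻ᵐ ⊗ b i` does not change from index `N i m` on
    let N : ν → ℤ → ℕ := fun i m => (m * (κ + 2) + d i + 1 - j).toNat
    have hstab : ∀ i m n, N i m ≤ n →
        (coordT b i (x n)).coeff m = (coordT b i (x (N i m))).coeff m := by
      intro i m n hn
      induction n, hn using Nat.le_induction with
      | base => rfl
      | succ n hn ih =>
        rw [← ih, ← sub_eq_zero]
        by_contra hne
        have := hx' n i m (by simpa using hne)
        have := Int.self_le_toNat (m * (κ + 2) + d i + 1 - j)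
        lia
    -- the coefficients of very negative index are those of `x 0`, so that the limit is a series
    have hbdd : ∀ i, BddBelow (Function.support fun m => (coordT b i (x (N i m))).coeff m) := by
      intro i
      obtain ⟨M, hM⟩ := exists_coeff_eq_zero (coordT b i (x 0))
      refine ⟨min M (min 0 (j - d i - 1)), fun m hm => ?_⟩
      by_contra hlt
      rw [not_le, lt_min_iff, lt_min_iff] at hlt
      apply hm
      have h0 : N i m = 0 := by
        have : m * (κ + 2) ≤ m := by nlinarith
        simp only [N, Int.toNat_eq_zero]
        lia
      simp only [h0]
      exact hM m hlt.1
    let s : ν → LaurentSeries A := fun i => HahnSeries.ofSuppBddBelow _ (hbdd i)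
    refine ⟨∑ i, s i ⊗ₜ[F] b i, fun n => (mem_loopFil b hb).2 fun i m hm => ?_⟩
    by_contra hlt
    apply hm
    rw [map_sub, coordT_sum, HahnSeries.coeff_sub, sub_eq_zero]
    exact (hstab i m n (by simp only [N]; lia)).symm

lemma loopDeriv_mem (D : Derivation F A A) {j : ℤ} {x : Loop F A g}
    (hx : x ∈ loopFil F A h κ j) : loopDeriv g D x ∈ loopFil F A h κ j := by
  rw [mem_loopFil b hb] at hx ⊢
  intro i n hn
  refine hx i n fun h0 => hn ?_
  have : coordT b i (loopDeriv g D x) = coeffMap D.toLinearMap (coordT b i x) :=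
    coordT_rTensor b _ i x
  rw [this]
  simp [coeffMap, h0]

end LoopFiltration

/-! ### The Euler derivation of the loop algebra -/

section EulerDerivation

variable {F : Type*} [Field F] {A : Type*} [CommRing A] [Algebra F A]

/-- Multiplication of the coefficient of `z⁻ⁿ` by the doubled degree `n (κ + 2)` of `z⁻ⁿ`. -/
def degreeMap (F : Type*) [Field F] (A : Type*) [CommRing A] [Algebra F A] (κ : ℤ) :
    LaurentSeries A →ₗ[F] LaurentSeries A where
  toFun s :=
    { coeff := fun n => ((n * (κ + 2) : ℤ) : F) • s.coeff n
      isPWO_support' := s.isPWO_support.mono fun n hn h0 => hn (by simp [h0]) }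
  map_add' x y := by ext n; simp
  map_smul' c x := by
    ext n
    exact smul_comm _ c (x.coeff n)

@[simp] lemma coeff_degreeMap (κ : ℤ) (s : LaurentSeries A) (n : ℤ) :
    (degreeMap F A κ s).coeff n = ((n * (κ + 2) : ℤ) : F) • s.coeff n := rfl

lemma degreeMap_mul (κ : ℤ) (x y : LaurentSeries A) :
    degreeMap F A κ (x * y) = x * degreeMap F A κ y + degreeMap F A κ x * y := by
  have hsub : ∀ u : LaurentSeries A, (degreeMap F A κ u).support ⊆ u.support := by
    intro u n hn hu
    exact hn (by simp [hu])
  ext n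
  rw [HahnSeries.coeff_add, HahnSeries.coeff_mul_right' y.isPWO_support (hsub y),
    HahnSeries.coeff_mul_left' x.isPWO_support (hsub x), ← Finset.sum_add_distrib]
  rw [coeff_degreeMap, HahnSeries.coeff_mul, Finset.smul_sum]
  refine Finset.sum_congr rfl fun p hp => ?_
  have hp' := (Finset.mem_antidiagonal.1 hp).2.2
  rw [coeff_degreeMap, coeff_degreeMap, mul_smul_comm, smul_mul_assoc, ← add_smul, ← hp']
  push_cast
  ring_nf

variable {g : Type*} [LieRing g] [LieAlgebra F g]

/-- The derivation of `A((z⁻¹)) ⊗ g` that multiplies homogeneous elements by their doubled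
degree. -/
def eulerDerivation (A : Type*) [CommRing A] [Algebra F A] (h : g) (κ : ℤ) :
    LieDerivation F (Loop F A g) (Loop F A g) where
  toLinearMap := (degreeMap F A κ).rTensor g + (LieAlgebra.ad F g h).lTensor (LaurentSeries A)
  leibniz' a b := by
    induction a using TensorProduct.induction_on with
    | zero => simp
    | add a a' ha ha' =>
      simp only [add_lie, lie_add, map_add] at *
      rw [ha, ha']
      abel
    | tmul s x =>
      induction b using TensorProduct.induction_on with
      | zero => simp
      | add b b' hb hb' =>
        simp only [add_lie, lie_add, map_add] at *
        rw [hb, hb']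
        abel
      | tmul t y =>
        simp only [LieAlgebra.ExtendScalars.bracket_tmul, LinearMap.rTensor_tmul,
          LinearMap.add_apply, LinearMap.lTensor_tmul, LieAlgebra.ad_apply, lie_add,
          degreeMap_mul, TensorProduct.add_tmul]
        rw [← lie_skew y x, mul_comm t, mul_comm t, leibniz_lie h x y, ← lie_skew y ⁅h, x⁆,
          TensorProduct.tmul_neg, TensorProduct.tmul_neg, TensorProduct.tmul_add]
        abel

lemma eulerDerivation_tmul (h : g) (κ : ℤ) (s : LaurentSeries A) (x : g) :
    eulerDerivation A h κ (s ⊗ₜ[F] x) = degreeMap F A κ s ⊗ₜ[F] x + s ⊗ₜ[F] ⁅h, x⁆ := rfl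

lemma eulerDerivation_loopDeriv (D : Derivation F A A) (h : g) (κ : ℤ) (x : Loop F A g) :
    eulerDerivation A h κ (loopDeriv g D x) = loopDeriv g D (eulerDerivation A h κ x) := by
  have hD : ∀ (s : LaurentSeries A) (x : g),
    loopDeriv g D (s ⊗ₜ[F] x) = coeffMap D.toLinearMap s ⊗ₜ[F] x := fun _ _ => rfl
  induction x using TensorProduct.induction_on with
  | zero => simp
  | add x y hx hy => simp only [map_add, hx, hy]
  | tmul s x =>
    rw [hD, eulerDerivation_tmul, eulerDerivation_tmul, map_add, hD, hD]
    congr 2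
    ext n
    simp [coeffMap]

lemma eulerDerivation_sub_mem [CharZero F] {ν : Type*} [Fintype ν] [DecidableEq ν]
    (b : Module.Basis ν F g) {h : g} {d : ν → ℤ} (hb : ∀ i, b i ∈ grade F h (d i)) {κ : ℤ} (j : ℤ)
    (x : Loop F A g) (hx : x ∈ loopFil F A h κ j) :
    eulerDerivation A h κ x - (j : F) • x ∈ loopFil F A h κ (j + 1) := by
  have hc : eulerDerivation A h κ x
      = ∑ i, (degreeMap F A κ (coordT b i x) + (d i : F) • coordT b i x) ⊗ₜ[F] b i := by
    conv_lhs => rw [← sum_coordT b x]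
    rw [map_sum]
    refine Finset.sum_congr rfl fun i _ => ?_
    rw [eulerDerivation_tmul, mem_grade.1 (hb i), TensorProduct.add_tmul,
      TensorProduct.tmul_smul, TensorProduct.smul_tmul']
  rw [mem_loopFil b hb] at hx ⊢
  intro i n hn
  have h1 : (coordT b i (eulerDerivation A h κ x - (j : F) • x)).coeff n
      = ((n * (κ + 2) + d i - j : ℤ) : F) • (coordT b i x).coeff n := by
    rw [map_sub, hc, coordT_sum, map_smul]
    simp only [HahnSeries.coeff_sub, HahnSeries.coeff_add, HahnSeries.coeff_smul, coeff_degreeMap]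
    push_cast
    module
  rw [h1] at hn
  have h2 := hx i n (right_ne_zero_of_smul hn)
  have h3 : n * (κ + 2) + d i - j ≠ 0 := by
    intro h0
    rw [h0] at hn
    simp at hn
  lia

end EulerDerivation

/-! ### Homogeneous pseudo-inverses and nilpotent perturbations -/

section Splitting

variable {F : Type*} [Field F] {L : Type*} [AddCommGroup L] [Module F L]

/-- `R` is a pseudo-inverse of the operator `T`, and commutes with it; moreover `T` lowers degrees
by `2` and `R` raises them by `2`. Then `T R` is the projection onto the range of `T` along its
kernel, and is compatible with the filtration. -/
structure IsSplitting (Fil : ℤ → Submodule F L) (T R : Module.End F L) : Prop where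
  mul_mul : T * R * T = T
  comm : Commute T R
  map_T : ∀ j, ∀ x ∈ Fil j, T x ∈ Fil (j - 2)
  map_R : ∀ j, ∀ x ∈ Fil j, R x ∈ Fil (j + 2)

namespace IsSplitting

variable {Fil : ℤ → Submodule F L} {T R N : Module.End F L} (hS : IsSplitting Fil T R)
include hS

lemma apply_apply_apply (x : L) : T (R (T x)) = T x := LinearMap.congr_fun hS.mul_mul x

lemma apply_comm (x : L) : R (T x) = T (R x) := (LinearMap.congr_fun hS.comm.eq x).symm

lemma proj_mem {j : ℤ} {x : L} (hx : x ∈ Fil j) : T (R x) ∈ Fil j := by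
  simpa using hS.map_T _ _ (hS.map_R j x hx)

lemma mem_range_iff {x : L} : x ∈ LinearMap.range T ↔ T (R x) = x :=
  ⟨by rintro ⟨y, rfl⟩; exact hS.apply_apply_apply y, fun h => ⟨_, h⟩⟩

lemma mem_ker_iff {x : L} : x ∈ LinearMap.ker T ↔ T (R x) = 0 := by
  rw [LinearMap.mem_ker]
  refine ⟨fun h => by rw [← hS.apply_comm, h, map_zero], fun h => ?_⟩
  rw [← hS.apply_apply_apply, hS.apply_comm, h, map_zero]

lemma sub_proj_mem_ker (x : L) : x - T (R x) ∈ LinearMap.ker T := by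
  rw [LinearMap.mem_ker, map_sub, ← hS.apply_comm, hS.apply_apply_apply, sub_self]

variable (hNT : Commute N T) (hNR : Commute N R) (hN : ∀ j, ∀ x ∈ Fil j, N x ∈ Fil (j - 2))
include hNT hNR hN

/-- If `N` is nilpotent and commutes with `T` and `R`, then `T + N` maps the range of `T` onto
itself, with preimages of the expected degree. The solution is `u = R p - R N R p + …`. -/
lemma exists_solution (k : ℕ) : ∀ {j : ℤ} {p : L}, p ∈ LinearMap.range T → p ∈ Fil j →
    (N ^ k) p = 0 → ∃ u ∈ LinearMap.range T, u ∈ Fil (j + 2) ∧ T u + N u = p := by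
  have hNT' : ∀ x, N (T x) = T (N x) := fun x => LinearMap.congr_fun hNT.eq x
  have hNR' : ∀ x, N (R x) = R (N x) := fun x => LinearMap.congr_fun hNR.eq x
  induction k with
  | zero =>
    intro j p _ _ h0
    exact ⟨0, zero_mem _, zero_mem _, by simpa using h0.symm⟩
  | succ k ih =>
    intro j p hp hpj hk
    have hRp : R p ∈ LinearMap.range T := by
      obtain ⟨x, rfl⟩ := hp
      exact ⟨R x, (hS.apply_comm x).symm⟩
    obtain ⟨u, hu, huj, hup⟩ := ih (j := j) (p := N (R p))
      (by obtain ⟨x, hx⟩ := hRp; exact ⟨N x, by rw [← hx, hNT']⟩)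
      (by simpa using hN _ _ (hS.map_R j p hpj))
      (by
        rw [← Module.End.mul_apply, ← pow_succ, ← Module.End.mul_apply,
          (hNR.pow_left (k + 1)).eq, Module.End.mul_apply, hk, map_zero])
    refine ⟨R p - u, sub_mem hRp hu, sub_mem (hS.map_R j p hpj) huj, ?_⟩
    rw [map_sub, map_sub, hS.mem_range_iff.1 hp, sub_add_sub_comm, hup, add_sub_cancel_right]

/-- If `N` is nilpotent and commutes with `T` and `R`, then on the range of `T` the degree of `u` is
controlled by that of `(T + N) u`, even modulo the kernel of `T`. -/
lemma mem_of_apply_mem (hNn : IsNilpotent N) {j : ℤ} {u q : L} (hu : u ∈ LinearMap.range T)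
    (hq : q ∈ LinearMap.ker T) (h : T u + N u + q ∈ Fil j) : u ∈ Fil (j + 2) := by
  have hNT' : ∀ x, N (T x) = T (N x) := fun x => LinearMap.congr_fun hNT.eq x
  have hNR' : ∀ x, N (R x) = R (N x) := fun x => LinearMap.congr_fun hNR.eq x
  have hTR := hS.mem_range_iff.1 hu
  -- apply `R T R` to the hypothesis; this kills `q`, and `R T u = u`
  have h1 : u + N (R u) ∈ Fil (j + 2) := by
    have := hS.map_R _ _ (hS.proj_mem h)
    rwa [map_add R, map_add T, hS.mem_ker_iff.1 hq, add_zero, map_add R, map_add T,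
      hS.apply_apply_apply, map_add R, hS.apply_comm u, hTR, ← hNR', ← hNT', hTR, ← hNR'] at this
  have hit : ∀ (i : ℕ) (x : L), x ∈ Fil (j + 2) → ((N * R) ^ i) x ∈ Fil (j + 2) := by
    intro i
    induction i with
    | zero => simp
    | succ i ih =>
      intro x hx
      rw [pow_succ', Module.End.mul_apply, Module.End.mul_apply]
      simpa using hN _ _ (hS.map_R _ _ (ih x hx))
  obtain ⟨k, hk⟩ := hNn
  have hk' : ((N * R) ^ k) u = 0 := by rw [hNR.mul_pow, hk, zero_mul, LinearMap.zero_apply]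
  -- `u = (u + N R u) - N R u`, iterated until a power of the nilpotent `N R` kills `u`
  have hdown : ∀ k, ((N * R) ^ k) u ∈ Fil (j + 2) → u ∈ Fil (j + 2) := by
    intro k
    induction k with
    | zero => simp
    | succ k ih =>
      intro hk
      refine ih ?_
      have := hit k _ h1
      rw [map_add, ← Module.End.mul_apply N R, ← Module.End.mul_apply _ (N * R), ← pow_succ] at this
      exact (Submodule.add_mem_iff_left _ hk).1 this
  exact hdown k (by rw [hk']; exact zero_mem _)

end IsSplitting

end Splitting

/-! ### The pseudo-inverse of `ad (f₁ + z E)` -/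

section LoopSplitting

variable {F : Type*} [Field F] {A : Type*} [CommRing A] [Algebra F A]
  {g : Type*} [LieRing g] [LieAlgebra F g]

/-- Multiplication by a scalar Laurent series. -/
def mulSeries (s : LaurentSeries A) : Module.End F (Loop F A g) :=
  (LinearMap.mulLeft F s).rTensor g

@[simp] lemma mulSeries_tmul (s t : LaurentSeries A) (x : g) :
    mulSeries s (t ⊗ₜ[F] x) = (s * t) ⊗ₜ[F] x := rfl

lemma commute_mulSeries_ad (s : LaurentSeries A) (y : Loop F A g) :
    Commute (mulSeries s) (LieAlgebra.ad F (Loop F A g) y) := by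
  refine LinearMap.ext fun x => ?_
  simp only [Module.End.mul_apply, LieAlgebra.ad_apply]
  induction x using TensorProduct.induction_on with
  | zero => simp
  | add x x' hx hx' => simp only [lie_add, map_add, hx, hx']
  | tmul t x =>
    induction y using TensorProduct.induction_on with
    | zero => simp
    | add y y' hy hy' => simp only [add_lie, map_add, hy, hy']
    | tmul u y =>
      simp only [LieAlgebra.ExtendScalars.bracket_tmul, mulSeries_tmul]
      rw [mul_left_comm]

lemma commute_mulSeries (s t : LaurentSeries A) :
    Commute (mulSeries s : Module.End F (Loop F A g)) (mulSeries t) := by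
  refine LinearMap.ext fun x => ?_
  simp only [Module.End.mul_apply]
  induction x using TensorProduct.induction_on with
  | zero => simp
  | add x x' hx hx' => simp only [map_add, hx, hx']
  | tmul u x => simp only [mulSeries_tmul, mul_left_comm]

/-- The operator `ad (f₁ + z E)` on `A((z⁻¹)) ⊗ g`. -/
def adCyc (F A : Type*) [Field F] [CommRing A] [Algebra F A] {g : Type*} [LieRing g]
    [LieAlgebra F g] (f₁ E : g) : Module.End F (Loop F A g) :=
  LieAlgebra.ad F (Loop F A g) (cyc A f₁ E)

lemma adCyc_single (f₁ E : g) (n : ℤ) (x : g) :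
    adCyc F A f₁ E (HahnSeries.single n 1 ⊗ₜ[F] x)
      = HahnSeries.single n 1 ⊗ₜ[F] ⁅f₁, x⁆ + HahnSeries.single (n - 1) 1 ⊗ₜ[F] ⁅E, x⁆ := by
  simp only [adCyc, LieAlgebra.ad_apply, cyc, monom, add_lie,
    LieAlgebra.ExtendScalars.bracket_tmul, HahnSeries.single_mul_single, mul_one]
  congr 3
  · rw [neg_zero, zero_add]
  · rw [neg_add_eq_sub]

section Lift

variable {ν : Type*} (b : Module.Basis ν F g) (d : ν → ℤ)

/-- The part of `x ∈ g` that lifts to an element of doubled degree `e` of `A((z⁻¹)) ⊗ g`, lifted in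
this way: a homogeneous `x` of degree `d` goes to the multiple `zⁿ ⊗ x` of degree `e`, or to `0` if
there is none. The lift takes `ad (f₁ + E)` to `ad (f₁ + z E)`, see `adCyc_homogenize`. -/
def homogenize (A : Type*) [CommRing A] [Algebra F A] (κ e : ℤ) : g →ₗ[F] Loop F A g :=
  b.constr F fun i =>
    if (κ + 2) ∣ e - d i then HahnSeries.single ((e - d i) / (κ + 2)) 1 ⊗ₜ[F] b i else 0

variable {d} {h : g} (hb : ∀ i, b i ∈ grade F h (d i)) {κ : ℤ}

lemma homogenize_of_mem_grade [Finite ν] [CharZero F] (hb : ∀ i, b i ∈ grade F h (d i)) (e : ℤ)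
    {x : g} {i : ℤ} (hx : x ∈ grade F h i) : homogenize b d A κ e x
      = if (κ + 2) ∣ e - i then HahnSeries.single ((e - i) / (κ + 2)) 1 ⊗ₜ[F] x else 0 := by
  have := Fintype.ofFinite ν
  have h1 : ∀ k, b.repr x k • homogenize b d A κ e (b k) = b.repr x k •
      if (κ + 2) ∣ e - i then HahnSeries.single ((e - i) / (κ + 2)) 1 ⊗ₜ[F] b k else 0 := by
    intro k
    by_cases hk : d k = i
    · rw [homogenize, Module.Basis.constr_basis, hk]
    · rw [repr_eq_zero_of_mem_grade b hb hx hk, zero_smul, zero_smul]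
  conv_lhs => rw [← b.sum_repr x]
  conv_rhs => rw [← b.sum_repr x]
  rw [map_sum]
  simp only [map_smul, h1]
  split_ifs
  · simp only [TensorProduct.tmul_sum, TensorProduct.tmul_smul]
  · simp

variable [Finite ν] [CharZero F]
include hb

lemma adCyc_homogenize (hκ : 0 < κ + 2) {f₁ E : g} (hf₁ : f₁ ∈ grade F h (-2))
    (hE : E ∈ grade F h κ) (e : ℤ) (x : g) : adCyc F A f₁ E (homogenize b d A κ e x)
      = homogenize b d A κ (e - 2) (LieAlgebra.ad F g (f₁ + E) x) := by
  suffices adCyc F A f₁ E ∘ₗ homogenize b d A κ e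
      = homogenize b d A κ (e - 2) ∘ₗ LieAlgebra.ad F g (f₁ + E) from LinearMap.congr_fun this x
  refine b.ext fun i => ?_
  rw [LinearMap.comp_apply, LinearMap.comp_apply, LieAlgebra.ad_apply, add_lie, map_add]
  rw [homogenize_of_mem_grade b hb _ (hb i),
    homogenize_of_mem_grade b hb _ (lie_mem_grade hf₁ (hb i)),
    homogenize_of_mem_grade b hb _ (lie_mem_grade hE (hb i))]
  have e1 : e - 2 - (-2 + d i) = e - d i := by ring
  have e2 : e - 2 - (κ + d i) = e - d i - (κ + 2) := by ring
  rw [e1, e2]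
  by_cases hdvd : (κ + 2) ∣ e - d i
  · rw [if_pos hdvd, if_pos hdvd, if_pos (dvd_sub_self_right.2 hdvd), adCyc_single,
      Int.sub_ediv_of_dvd _ (dvd_refl _), Int.ediv_self hκ.ne']
  · rw [if_neg hdvd, if_neg hdvd, if_neg (fun h => hdvd (dvd_sub_self_right.1 h)), map_zero,
      add_zero]

lemma adCyc_pow_homogenize (hκ : 0 < κ + 2) {f₁ E : g} (hf₁ : f₁ ∈ grade F h (-2))
    (hE : E ∈ grade F h κ) (k : ℕ) (e : ℤ) (x : g) : (adCyc F A f₁ E ^ k) (homogenize b d A κ e x)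
      = homogenize b d A κ (e - 2 * k) ((LieAlgebra.ad F g (f₁ + E) ^ k) x) := by
  induction k with
  | zero => simp
  | succ k ih =>
    rw [pow_succ', Module.End.mul_apply, ih, adCyc_homogenize b hb hκ hf₁ hE, pow_succ',
      Module.End.mul_apply]
    congr 2
    push_cast
    ring

lemma mulSeries_homogenize (hκ : 0 < κ + 2) (n e : ℤ) (x : g) :
    mulSeries (HahnSeries.single n 1) (homogenize b d A κ e x)
      = homogenize b d A κ (e + n * (κ + 2)) x := by
  suffices mulSeries (HahnSeries.single n 1) ∘ₗ homogenize b d A κ e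
      = homogenize b d A κ (e + n * (κ + 2)) from LinearMap.congr_fun this x
  refine b.ext fun i => ?_
  rw [LinearMap.comp_apply, homogenize_of_mem_grade b hb _ (hb i),
    homogenize_of_mem_grade b hb _ (hb i),
    add_sub_right_comm]
  by_cases hdvd : (κ + 2) ∣ e - d i
  · rw [if_pos hdvd, if_pos ((Int.dvd_add_left (dvd_mul_left _ _)).2 hdvd), mulSeries_tmul,
      HahnSeries.single_mul_single, mul_one, Int.add_mul_ediv_right _ _ hκ.ne', add_comm]
  · rw [if_neg hdvd, if_neg (fun h => hdvd ((Int.dvd_add_left (dvd_mul_left _ _)).1 h)), map_zero]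

end Lift

/-- A semisimple operator has a pseudo-inverse that is a polynomial in it, because `X²` does not
divide the minimal polynomial. -/
lemma exists_pow_two_mul_aeval {V : Type*} [AddCommGroup V] [Module F V] [FiniteDimensional F V]
    {T : Module.End F V} (hT : T.IsSemisimple) :
    ∃ r : Polynomial F, T ^ 2 * Polynomial.aeval T r = T := by
  obtain ⟨u, v, huv⟩ : ∃ u v : Polynomial F,
      Polynomial.X ^ 2 * u + v * minpoly F T = Polynomial.X := by
    have hco : ∀ q : Polynomial F, IsCoprime Polynomial.X q ∨ Polynomial.X ∣ q := fun q =>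
      (em _).symm.imp_left Polynomial.irreducible_X.coprime_iff_not_dvd.2
    rcases hco (minpoly F T) with hc | ⟨q, hq⟩
    · obtain ⟨u, v, huv⟩ := hc
      refine ⟨u, v * Polynomial.X, ?_⟩
      linear_combination Polynomial.X * huv
    · have hsq := hT.minpoly_squarefree
      rw [hq] at hsq ⊢
      rcases hco q with hc | ⟨p, rfl⟩
      · obtain ⟨u, v, huv⟩ := hc
        refine ⟨u, v, ?_⟩
        linear_combination Polynomial.X * huv
      · exact absurd (hsq Polynomial.X ⟨p, by ring⟩) Polynomial.not_isUnit_X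
  refine ⟨u, ?_⟩
  have := congrArg (Polynomial.aeval T) huv
  simpa using this

/-- The homogenization of `r (ad (f₁ + E))`: the power `ad (f₁ + E)ⁱ` is replaced by
`zⁿ ad (f₁ + z E)ⁱ`, for the `n` which makes this operator raise doubled degrees by `2`, or by `0`
if there is no such `n`. -/
def quasiInverse (A : Type*) [CommRing A] [Algebra F A] (f₁ E : g) (κ : ℤ) (r : Polynomial F) :
    Module.End F (Loop F A g) :=
  ∑ i ∈ Finset.range (r.natDegree + 1), if (κ + 2) ∣ 2 * (i + 1) then
    r.coeff i • (mulSeries (HahnSeries.single ((2 * (i + 1)) / (κ + 2)) 1) * adCyc F A f₁ E ^ i)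
    else 0

lemma commute_quasiInverse {f₁ E : g} {κ : ℤ} {r : Polynomial F} {N : Module.End F (Loop F A g)}
    (h1 : Commute N (adCyc F A f₁ E)) (h2 : ∀ s : LaurentSeries A, Commute N (mulSeries s)) :
    Commute N (quasiInverse A f₁ E κ r) := by
  refine Commute.sum_right _ _ _ fun i _ => ?_
  split_ifs
  · exact ((h2 _).mul_right (h1.pow_right i)).smul_right _
  · exact Commute.zero_right _

/-- The homogenization of a polynomial pseudo-inverse of `ad (f₁ + E)` is a pseudo-inverse of
`ad (f₁ + z E)`. Both sides of the identity to be proved are linear over `A((z⁻¹))`, so that it is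
enough to check it on a homogeneous basis of `g`, where it follows by homogenization. -/
theorem isSplitting_loop [CharZero F] {ν : Type*} [Fintype ν] [DecidableEq ν]
    (b : Module.Basis ν F g) {h : g} {d : ν → ℤ} (hb : ∀ i, b i ∈ grade F h (d i)) {κ : ℤ}
    (hκ : 0 < κ + 2) {f₁ E : g} (hf₁ : f₁ ∈ grade F h (-2)) (hE : E ∈ grade F h κ)
    {r : Polynomial F} (hr : (LieAlgebra.ad F g (f₁ + E)) ^ 2
      * Polynomial.aeval (LieAlgebra.ad F g (f₁ + E)) r = LieAlgebra.ad F g (f₁ + E)) :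
    IsSplitting (loopFil F A h κ) (adCyc F A f₁ E) (quasiInverse A f₁ E κ r) := by
  have hF := loopFil_complete (A := A) b hb hκ
  have hTs : ∀ s : LaurentSeries A, Commute (adCyc F A f₁ E) (mulSeries s) := fun s =>
    (commute_mulSeries_ad s _).symm
  have hTR : Commute (adCyc F A f₁ E) (quasiInverse A f₁ E κ r) :=
    commute_quasiInverse (Commute.refl _) hTs
  have hcyc : cyc A f₁ E ∈ loopFil F A h κ (-2) := by
    refine add_mem (tmul_mem_loopFil hf₁ fun n hn => ?_) (tmul_mem_loopFil hE fun n hn => ?_)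
    · rw [HahnSeries.coeff_single] at hn
      have : n = 0 := by by_contra hne; exact hn (by simp [hne])
      simp [this]
    · have : n = -1 := by by_contra hne; exact hn (HahnSeries.coeff_single_of_ne hne)
      simp [this]
  have hT : ∀ j, ∀ x ∈ loopFil F A h κ j, adCyc F A f₁ E x ∈ loopFil F A h κ (j - 2) := by
    intro j x hx
    have := hF.lie_mem hcyc hx
    rwa [neg_add_eq_sub] at this
  have hTk : ∀ (k : ℕ) j, ∀ x ∈ loopFil F A h κ j,
      (adCyc F A f₁ E ^ k) x ∈ loopFil F A h κ (j - 2 * k) := by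
    intro k
    induction k with
    | zero => simp
    | succ k ih =>
      intro j x hx
      rw [pow_succ', Module.End.mul_apply]
      convert hT _ _ (ih j x hx) using 2
      push_cast
      ring
  have hM : ∀ (n : ℤ) j, ∀ x ∈ loopFil F A h κ j,
      mulSeries (HahnSeries.single n 1) x ∈ loopFil F A h κ (j + n * (κ + 2)) := by
    intro n j x hx
    rw [mem_loopFil b hb] at hx ⊢
    intro i m hm
    have hco : coordT b i (mulSeries (HahnSeries.single n 1) x)
        = HahnSeries.single n 1 * coordT b i x := coordT_rTensor b _ i x
    rw [hco, HahnSeries.coeff_single_mul, one_mul] at hm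
    have := hx i _ hm
    rw [sub_mul] at this
    lia
  refine ⟨?_, hTR, hT, ?_⟩
  · have hTRT : adCyc F A f₁ E * quasiInverse A f₁ E κ r * adCyc F A f₁ E
        = quasiInverse A f₁ E κ r * adCyc F A f₁ E ^ 2 := by
      rw [hTR.eq, mul_assoc, pow_two]
    rw [hTRT]
    have hcomm : ∀ s : LaurentSeries A, Commute (mulSeries s)
        (quasiInverse A f₁ E κ r * adCyc F A f₁ E ^ 2) := fun s =>
      (commute_quasiInverse (hTs s).symm fun t => commute_mulSeries s t).mul_right
        ((hTs s).symm.pow_right 2)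
    have key : ∀ i, (quasiInverse A f₁ E κ r * adCyc F A f₁ E ^ 2) ((1 : LaurentSeries A) ⊗ₜ[F] b i)
        = adCyc F A f₁ E ((1 : LaurentSeries A) ⊗ₜ[F] b i) := by
      intro i
      have h1 : (1 : LaurentSeries A) ⊗ₜ[F] b i = homogenize b d A κ (d i) (b i) := by
        rw [homogenize_of_mem_grade b hb _ (hb i)]
        simp
      rw [h1, quasiInverse, Finset.sum_mul, LinearMap.sum_apply, adCyc_homogenize b hb hκ hf₁ hE]
      conv_rhs => rw [← hr, Polynomial.aeval_eq_sum_range]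
      rw [Finset.mul_sum, LinearMap.sum_apply, map_sum]
      refine Finset.sum_congr rfl fun k _ => ?_
      rw [mul_smul_comm, LinearMap.smul_apply, map_smul, ← pow_add]
      split_ifs with hdvd
      · rw [smul_mul_assoc, LinearMap.smul_apply, mul_assoc, ← pow_add, Module.End.mul_apply,
          adCyc_pow_homogenize b hb hκ hf₁ hE, mulSeries_homogenize b hb hκ,
          Int.ediv_mul_cancel hdvd, add_comm k 2]
        congr 2
        push_cast
        ring_nf
      · rw [zero_mul, LinearMap.zero_apply]
        -- this term of `r` contributes nothing, as `b i` has no lift of the degree in question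
        have := adCyc_pow_homogenize (A := A) b hb hκ hf₁ hE (2 + k)
          (d i - 2 + 2 * (2 + k : ℕ)) (b i)
        rw [add_sub_cancel_right] at this
        rw [← this, homogenize_of_mem_grade b hb _ (hb i), if_neg, map_zero, smul_zero]
        intro h
        apply hdvd
        convert h using 1
        push_cast
        ring
    refine LinearMap.ext fun x => ?_
    rw [← sum_coordT b x, map_sum, map_sum]
    refine Finset.sum_congr rfl fun i _ => ?_
    have e1 : coordT b i x ⊗ₜ[F] b i
        = mulSeries (coordT b i x) ((1 : LaurentSeries A) ⊗ₜ[F] b i) := by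
      rw [mulSeries_tmul, mul_one]
    rw [e1, ← Module.End.mul_apply, ← (hcomm _).eq, Module.End.mul_apply, key,
      ← Module.End.mul_apply, ← Module.End.mul_apply, (hTs _).eq]
  · intro j x hx
    rw [quasiInverse, LinearMap.sum_apply]
    refine sum_mem fun k _ => ?_
    split_ifs with hdvd
    · rw [LinearMap.smul_apply, Module.End.mul_apply]
      refine Submodule.smul_mem _ _ ?_
      have := hM (2 * (k + 1) / (κ + 2)) _ _ (hTk k j x hx)
      rw [Int.ediv_mul_cancel hdvd] at this
      convert this using 2
      ring
    · exact zero_mem _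

end LoopSplitting

/-! ### Completed tensor products with a direct summand -/

section HatTensor

variable {F : Type*} [Field F] {A : Type*} [CommRing A] [Algebra F A]
  {g : Type*} [LieRing g] [LieAlgebra F g]

lemma pureLoop_tmul (a : A) (s : LaurentSeries F) (x : g) :
    pureLoop a (s ⊗ₜ[F] x) = coeffMap (LinearMap.toSpanSingleton F A a) s ⊗ₜ[F] x := rfl

lemma coeffMap_single (a : A) (n : ℤ) (c : F) :
    coeffMap (LinearMap.toSpanSingleton F A a) (HahnSeries.single n c)
      = HahnSeries.single n (c • a) := by
  ext m
  by_cases hm : m = n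
  · simp [coeffMap, hm]
  · simp [coeffMap, HahnSeries.coeff_single_of_ne hm]

lemma coeffMap_single_mul (a : A) (n : ℤ) (s : LaurentSeries F) :
    coeffMap (LinearMap.toSpanSingleton F A a) (HahnSeries.single n 1 * s)
      = HahnSeries.single n 1 * coeffMap (LinearMap.toSpanSingleton F A a) s := by
  ext m
  rw [HahnSeries.coeff_single_mul]
  simp [coeffMap, HahnSeries.coeff_single_mul]

lemma pureLoop_mulSeries (a : A) (n : ℤ) (x : Loop F F g) :
    pureLoop a (mulSeries (HahnSeries.single n 1) x)
      = mulSeries (HahnSeries.single n 1) (pureLoop a x) := by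
  induction x using TensorProduct.induction_on with
  | zero => simp
  | add x y hx hy => simp only [map_add, hx, hy]
  | tmul s x =>
    rw [mulSeries_tmul, pureLoop_tmul, pureLoop_tmul, mulSeries_tmul, coeffMap_single_mul]

lemma pureLoop_adCyc (a : A) (f₁ E : g) (x : Loop F F g) :
    pureLoop a (adCyc F F f₁ E x) = adCyc F A f₁ E (pureLoop a x) := by
  induction x using TensorProduct.induction_on with
  | zero => simp
  | add x y hx hy => simp only [map_add, hx, hy]
  | tmul s x =>
    simp only [adCyc, cyc, monom, LieAlgebra.ad_apply, add_lie,
      LieAlgebra.ExtendScalars.bracket_tmul]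
    rw [map_add, pureLoop_tmul, pureLoop_tmul, pureLoop_tmul, coeffMap_single_mul,
      coeffMap_single_mul, LieAlgebra.ExtendScalars.bracket_tmul,
      LieAlgebra.ExtendScalars.bracket_tmul]

lemma pureLoop_quasiInverse (a : A) (f₁ E : g) (κ : ℤ) (r : Polynomial F) (x : Loop F F g) :
    pureLoop a (quasiInverse F f₁ E κ r x) = quasiInverse A f₁ E κ r (pureLoop a x) := by
  have hpow : ∀ k : ℕ, pureLoop a ((adCyc F F f₁ E ^ k) x)
      = (adCyc F A f₁ E ^ k) (pureLoop a x) := by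
    intro k
    induction k with
    | zero => simp
    | succ k ih =>
      rw [pow_succ', pow_succ', Module.End.mul_apply, Module.End.mul_apply, pureLoop_adCyc, ih]
  simp only [quasiInverse, LinearMap.sum_apply, map_sum]
  refine Finset.sum_congr rfl fun i _ => ?_
  split_ifs
  · simp only [LinearMap.smul_apply, Module.End.mul_apply, map_smul, pureLoop_mulSeries, hpow]
  · simp

variable [CharZero F] {ν : Type*} [Fintype ν] [DecidableEq ν]
    (b : Module.Basis ν F g) {h : g} {d : ν → ℤ} (hb : ∀ i, b i ∈ grade F h (d i)) {κ : ℤ}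
include hb

lemma pureLoop_mem (a : A) {j : ℤ} {x : Loop F F g} (hx : x ∈ loopGT F F h κ j) :
    pureLoop a x ∈ loopGT F A h κ j := by
  rw [mem_loopGT b hb] at hx ⊢
  intro i n hn
  refine hx i n fun h0 => hn ?_
  have : coordT b i (pureLoop a x) = coeffMap (LinearMap.toSpanSingleton F A a) (coordT b i x) :=
    coordT_rTensor b _ i x
  rw [this]
  simp [coeffMap, h0]

/-- Elements of `loopGT` are limits of finite sums of pure elements of the same degrees. -/
lemma mem_span_pureLoop_sup (hκ : 0 < κ + 2) {s : ℤ} {y : Loop F A g} (hy : y ∈ loopGT F A h κ s)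
    (j : ℤ) : y ∈ Submodule.span F {y | ∃ a : A, ∃ x ∈ loopGT F F h κ s, y = pureLoop a x}
      ⊔ loopGT F A h κ j := by
  rw [mem_loopGT b hb] at hy
  rw [← sum_coordT b y]
  refine sum_mem fun i _ => ?_
  obtain ⟨N, hN⟩ := exists_coeff_eq_zero (coordT b i y)
  -- the monomials `z⁻ⁿ ⊗ b i` with `n ≥ M` have degree greater than `j`, as `κ + 2 ≥ 1`
  set M := max 0 (j - d i + 1)
  set p : LaurentSeries A := ∑ n ∈ Finset.Ico N M, HahnSeries.single n ((coordT b i y).coeff n)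
    with hp
  rw [← add_sub_cancel p (coordT b i y), TensorProduct.add_tmul]
  refine Submodule.add_mem_sup ?_ ?_
  · rw [hp, TensorProduct.sum_tmul]
    refine sum_mem fun n _ => ?_
    by_cases h0 : (coordT b i y).coeff n = 0
    · simp [h0]
    refine Submodule.subset_span ⟨(coordT b i y).coeff n, HahnSeries.single n 1 ⊗ₜ[F] b i,
      tmul_mem_loopGT (hb i) fun m hm => ?_, ?_⟩
    · have : m = n := by by_contra hne; exact hm (HahnSeries.coeff_single_of_ne hne)
      rw [this]
      exact hy i n h0
    · rw [pureLoop_tmul, coeffMap_single, one_smul]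
  · refine tmul_mem_loopGT (hb i) fun n hn => ?_
    have hc : p.coeff n = if n ∈ Finset.Ico N M then (coordT b i y).coeff n else 0 := by
      rw [hp, HahnSeries.coeff_sum]
      simp only [HahnSeries.coeff_single]
      convert Finset.sum_ite_eq _ n _
    have hM : M ≤ n := by
      by_contra hlt
      apply hn
      rw [HahnSeries.coeff_sub, hc]
      split_ifs with hmem
      · exact sub_self _
      · rw [hN n (by rw [Finset.mem_Ico] at hmem; lia), sub_zero]
    have h1 : 0 ≤ n := (le_max_left _ _).trans hM
    have h2 : j - d i + 1 ≤ n := (le_max_right _ _).trans hM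
    nlinarith

/-- If `W` is the range of a projection `π` of `g((z⁻¹))` that preserves degrees, and `π` extends to
`ϖ` on `A((z⁻¹)) ⊗ g`, then the completed tensor product with `W` is the range of `ϖ`. -/
theorem hatTensor_eq_of_projection (hκ : 0 < κ + 2) {π : Module.End F (Loop F F g)}
    {ϖ : Module.End F (Loop F A g)} (hπϖ : ∀ (a : A) x, pureLoop a (π x) = ϖ (pureLoop a x))
    (hπ : ∀ j, ∀ x ∈ loopFil F F h κ j, π x ∈ loopFil F F h κ j)
    (hϖ : ∀ j, ∀ x ∈ loopFil F A h κ j, ϖ x ∈ loopFil F A h κ j) (hππ : ∀ x, π (π x) = π x)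
    {W : Submodule F (Loop F F g)} {W' : Submodule F (Loop F A g)} (hW : ∀ x, x ∈ W ↔ π x = x)
    (hW' : ∀ x, x ∈ W' ↔ ϖ x = x) (s : ℤ) :
    hatTensor A h κ (W ⊓ loopGT F F h κ s) = W' ⊓ loopGT F A h κ s := by
  have hF := loopFil_complete (A := A) b hb hκ
  have hGT : ∀ j, loopGT F A h κ j = loopFil F A h κ (j + 1) := fun j => by simp [loopFil]
  have hGT' : ∀ j, loopGT F F h κ j = loopFil F F h κ (j + 1) := fun j => by simp [loopFil]
  apply le_antisymm
  · intro y hy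
    have hy' := fun j => (Submodule.mem_iInf _).1 hy j
    have hspan : ∀ u ∈ Submodule.span F {y | ∃ a : A, ∃ x ∈ W ⊓ loopGT F F h κ s, y = pureLoop a x},
        ϖ u = u ∧ u ∈ loopGT F A h κ s := by
      intro u hu
      induction hu using Submodule.span_induction with
      | mem u hu =>
        obtain ⟨a, x, hx, rfl⟩ := hu
        exact ⟨by rw [← hπϖ, (hW x).1 hx.1], pureLoop_mem b hb a hx.2⟩
      | zero => simp
      | add u v _ _ hu hv => exact ⟨by rw [map_add, hu.1, hv.1], add_mem hu.2 hv.2⟩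
      | smul c u _ hu => exact ⟨by rw [map_smul, hu.1], Submodule.smul_mem _ _ hu.2⟩
    constructor
    · change y ∈ W'
      rw [hW', ← sub_eq_zero]
      refine hF.sep _ fun j => ?_
      obtain ⟨u, hu, v, hv, rfl⟩ := Submodule.mem_sup.1 (hy' (j - 1))
      rw [map_add, (hspan u hu).1, add_sub_add_left_eq_sub]
      have hv' : v ∈ loopFil F A h κ j := hv
      exact sub_mem (hϖ j v hv') hv'
    · obtain ⟨u, hu, v, hv, rfl⟩ := Submodule.mem_sup.1 (hy' s)
      exact add_mem (hspan u hu).2 hv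
  · rintro y ⟨hyW, hys⟩
    refine (Submodule.mem_iInf _).2 fun j => ?_
    obtain ⟨u, hu, v, hv, rfl⟩ := Submodule.mem_sup.1 (mem_span_pureLoop_sup b hb hκ hys j)
    rw [← (hW' _).1 hyW, map_add]
    refine Submodule.add_mem_sup ?_ ?_
    · clear hyW hys
      induction hu using Submodule.span_induction with
      | mem u hu =>
        obtain ⟨a, x, hx, rfl⟩ := hu
        rw [← hπϖ]
        refine Submodule.subset_span ⟨a, π x, ⟨(hW _).2 (hππ x), ?_⟩, rfl⟩
        change π x ∈ loopGT F F h κ s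
        rw [hGT'] at hx ⊢
        exact hπ _ x hx
      | zero => simp
      | add u v _ _ hu hv => rw [map_add]; exact add_mem hu hv
      | smul c u _ hu => rw [map_smul]; exact Submodule.smul_mem _ _ hu
    · rw [hGT] at hv ⊢
      exact hϖ _ v hv

end HatTensor

open CompleteFiltration

/-! ### Exponentials in `F ∂ ⋉ (V ⊗ g((z⁻¹)))` -/

section TildeExp

variable {F : Type*} [Field F] {V : Type*} [CommRing V] [Algebra F V]
  {g : Type*} [LieRing g] [LieAlgebra F g] (D : Derivation F V V) {h : g} {κ : ℤ}

/-- The degree filtration of `F ∂ ⋉ (V ⊗ g((z⁻¹)))`, with `∂` in degree `0`. -/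
def tildeFil (h : g) (κ : ℤ) : ℤ → Submodule F (Tilde g D) :=
  semiDirectFil (loopFil F V h κ) (derivAction g D)

variable {D}

lemma incl_mem_tildeFil {j : ℤ} {x : Loop F V g} :
    incl D x ∈ tildeFil D h κ j ↔ x ∈ loopFil F V h κ j := inl_mem_semiDirectFil

lemma incl_injective : Function.Injective (incl D : Loop F V g → Tilde g D) :=
  LieAlgebra.SemiDirectSum.inl_injective _

lemma incl_sub (x y : Loop F V g) : incl D (x - y) = incl D x - incl D y := map_sub _ x y

lemma incl_add (x y : Loop F V g) : incl D (x + y) = incl D x + incl D y := map_add _ x y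

lemma exists_incl_of_right_eq_zero {x : Tilde g D} (hx : x.right = 0) : ∃ y, x = incl D y :=
  ⟨x.left, by ext <;> simp [incl, hx]⟩

lemma dPlus_mem_tildeFil {j : ℤ} (hj : j ≤ 0) {x : Loop F V g} (hx : x ∈ loopFil F V h κ j) :
    dPlus D x ∈ tildeFil D h κ j :=
  add_mem (inr_mem_semiDirectFil _ hj 1) (incl_mem_tildeFil.2 hx)

lemma dPlus_sub_dPlus (x y : Loop F V g) : dPlus D x - dPlus D y = incl D (x - y) := by
  rw [dPlus, dPlus, incl_sub, add_sub_add_left_eq_sub]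

lemma dPlus_injective : Function.Injective (dPlus D : Loop F V g → Tilde g D) := fun _ _ hxy =>
  incl_injective (D := D) (add_left_cancel hxy)

lemma lie_incl_dPlus (u x : Loop F V g) :
    ⁅incl D u, dPlus D x⁆
      = incl D (LieAlgebra.ad F (Loop F V g) u x - loopDeriv g D u) := by
  simp only [dPlus, incl, LieAlgebra.SemiDirectSum.inl_eq_mk, LieAlgebra.SemiDirectSum.inr_eq_mk,
    LieAlgebra.SemiDirectSum.add_eq_mk, LieAlgebra.SemiDirectSum.lie_eq_mk]
  simp [derivAction]
  rfl

/-- The automorphism `e^{ad U}` does not change the coefficient of `∂`. -/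
lemma right_exp_apply {U : Loop F V g} {φ : Tilde g D → Tilde g D}
    (hF : CompleteFiltration (tildeFil D h κ)) (hφ : IsExp (tildeFil D h κ) (incl D U) φ)
    (x : Tilde g D) : (φ x).right = x.right := by
  obtain ⟨j, hj⟩ := hF.exh x
  have hpow : ∀ k : ℕ, (((LieAlgebra.ad F (Tilde g D) (incl D U)) ^ (k + 1)) x).right = 0 := by
    intro k
    rw [pow_succ', Module.End.mul_apply, LieAlgebra.ad_apply]
    simp [incl]
  have hsum : ∀ n : ℕ, (expPart F (incl D U) (n + 1) x).right = x.right := by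
    intro n
    induction n with
    | zero => simp [expPart]
    | succ n ih =>
      rw [← ih, expPart, Finset.sum_range_succ]
      change (expPart F (incl D U) (n + 1) x).right + ((n + 1).factorial : F)⁻¹ •
        (((LieAlgebra.ad F (Tilde g D) (incl D U)) ^ (n + 1)) x).right = _
      rw [hpow, smul_zero, add_zero]
  have h1 := hφ j x hj ((-j).toNat + 1)
  have h2 := h1.2 (by have := Int.self_le_toNat (-j); push_cast; lia)
  rw [← hsum (-j).toNat, ← sub_eq_zero]
  exact h2

/-- Convergence at every point, at an unspecified rate, determines the same map as convergence at
the rate given by the filtration. -/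
lemma isExpAd_iff_isExp [CharZero F] (hF : CompleteFiltration (tildeFil D h κ)) {U : Loop F V g}
    (hU : U ∈ loopFil F V h κ 1) {φ : Tilde g D ≃ₗ⁅F⁆ Tilde g D} :
    IsExpAd D h κ U φ ↔ IsExp (tildeFil D h κ) (incl D U) φ := by
  have hpart : ∀ n x, ∑ k ∈ Finset.range n,
      ((k.factorial : F)⁻¹) • ((LieAlgebra.ad F (Tilde g D) (incl D U)) ^ k) x
        = expPart F (incl D U) n x := fun n x => by
    simp only [expPart, LinearMap.sum_apply, LinearMap.smul_apply]
  constructor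
  · intro hφ
    obtain ⟨ψ, hψ⟩ := hF.exists_exp (incl_mem_tildeFil.2 hU)
    suffices h : (φ : Tilde g D → Tilde g D) = ψ by rwa [h]
    funext x
    rw [← sub_eq_zero]
    refine hF.sep _ fun j => ?_
    obtain ⟨i, hi⟩ := hF.exh x
    obtain ⟨N, hN⟩ := hφ x (j - 1)
    obtain ⟨r, hr, hr'⟩ := hN (max N (j - i).toNat) (le_max_left _ _)
    have h1 := hψ i x hi (max N (j - i).toNat)
    rw [hpart] at hr'
    have h2 : incl D r ∈ tildeFil D h κ j := incl_mem_tildeFil.2 hr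
    have h3 := sub_mem h2 (hF.mem_of_le h1 (i := j) (by
      have := Int.self_le_toNat (j - i)
      push_cast
      lia))
    rw [hr']
    convert h3 using 1
    abel
  · intro hφ x j
    obtain ⟨i, hi⟩ := hF.exh x
    refine ⟨(max (j + 1) 1 - i).toNat, fun n hn => ?_⟩
    have h1 := hF.mem_of_le (hφ i x hi n) (i := max (j + 1) 1) (by
      have := Int.self_le_toNat (max (j + 1) 1 - i)
      lia)
    obtain ⟨r, hr, hr'⟩ := exists_inl_of_mem_semiDirectFil (by simp) h1
    refine ⟨r, ?_, ?_⟩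
    · have h2 := hF.mem_of_le h1 (le_max_left _ _)
      rw [hr'] at h2
      have h3 : r ∈ loopFil F V h κ (j + 1) := incl_mem_tildeFil.1 h2
      simpa [loopFil] using h3
    · rw [hpart]
      exact sub_eq_iff_eq_add'.1 hr'

end TildeExp

/-! ### Reduction to normal form -/

section Reduction

variable {F : Type*} [Field F] {V : Type*} [CommRing V] [Algebra F V]
  {g : Type*} [LieRing g] [LieAlgebra F g] {D : Derivation F V V} {h f₁ f₂ E : g} {κ : ℤ}

lemma cyc_add (f₁ f₂ E : g) : (cyc V (f₁ + f₂) E : Loop F V g) = cyc V f₁ E + monom 1 0 f₂ := by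
  simp only [cyc, monom, TensorProduct.tmul_add]
  abel

lemma loopDeriv_cyc (f₁ E : g) : loopDeriv g D (cyc V f₁ E) = 0 := by
  have h1 : ∀ (n : ℤ) (x : g), loopDeriv g D (monom 1 n x) = 0 := by
    intro n x
    have : coeffMap D.toLinearMap (HahnSeries.single (-n) (1 : V)) = 0 := by
      ext m
      by_cases hm : m = -n
      · simp [coeffMap, hm]
      · simp [coeffMap, HahnSeries.coeff_single_of_ne hm]
    change coeffMap D.toLinearMap (HahnSeries.single (-n) (1 : V)) ⊗ₜ[F] x = 0
    rw [this, TensorProduct.zero_tmul]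
  rw [cyc, map_add, h1, h1, add_zero]

lemma lie_cyc_monom (h₁₂ : ⁅f₁, f₂⁆ = 0) (hE₂ : ⁅f₂, E⁆ = 0) :
    LieAlgebra.ad F (Loop F V g) (cyc V f₁ E) (monom 1 0 f₂) = 0 := by
  have : ⁅E, f₂⁆ = 0 := by rw [← lie_skew, hE₂, neg_zero]
  simp only [cyc, monom, LieAlgebra.ad_apply, add_lie, LieAlgebra.ExtendScalars.bracket_tmul,
    h₁₂, this, TensorProduct.tmul_zero, add_zero]

lemma commute_ad_of_lie_eq_zero {L : Type*} [LieRing L] [LieAlgebra F L] {x y : L}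
    (hxy : ⁅x, y⁆ = 0) : Commute (LieAlgebra.ad F L x) (LieAlgebra.ad F L y) := by
  refine LinearMap.ext fun z => ?_
  simp only [Module.End.mul_apply, LieAlgebra.ad_apply]
  rw [leibniz_lie, hxy, zero_lie, zero_add]

lemma isNilpotent_ad_monom [CharZero F] [FiniteDimensional F g] (hf₂ : f₂ ∈ grade F h (-2)) :
    IsNilpotent (LieAlgebra.ad F (Loop F V g) (monom 1 0 f₂)) := by
  obtain ⟨k, hk⟩ : IsNilpotent (LieAlgebra.ad F g f₂) :=
    isNilpotent_of_shift (h := LieAlgebra.ad F g h) (c := -2) (by norm_num) fun v => by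
      simp only [LieAlgebra.ad_apply]
      rw [leibniz_lie, mem_grade.1 hf₂, smul_lie, add_comm]
      push_cast
      rfl
  refine ⟨k, ?_⟩
  have h1 : LieAlgebra.ad F (Loop F V g) (monom 1 0 f₂)
      = (LieAlgebra.ad F g f₂).lTensor (LaurentSeries V) := by
    refine TensorProduct.ext' fun s x => ?_
    simp [monom]
  have h2 : ∀ n : ℕ, ((LieAlgebra.ad F g f₂).lTensor (LaurentSeries V)) ^ n
      = ((LieAlgebra.ad F g f₂) ^ n).lTensor (LaurentSeries V) := fun n => by
    rw [LinearMap.lTensor_pow]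
  rw [h1, h2, hk, LinearMap.lTensor_zero]

/-- The bracket of `u` with `∂ + f + z E + x`; the last two terms on the right form the leading
part. -/
lemma lie_incl_dPlus_cyc (u x : Loop F V g) : ⁅incl D u, dPlus D (cyc V (f₁ + f₂) E + x)⁆
    = incl D (LieAlgebra.ad F (Loop F V g) u x - loopDeriv g D u
      - (adCyc F V f₁ E u + LieAlgebra.ad F (Loop F V g) (monom 1 0 f₂) u)) := by
  have hskew : ∀ v w : Loop F V g,
      LieAlgebra.ad F (Loop F V g) v w = -LieAlgebra.ad F (Loop F V g) w v := fun v w => by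
    rw [LieAlgebra.ad_apply, LieAlgebra.ad_apply, lie_skew]
  rw [lie_incl_dPlus, cyc_add, map_add, map_add, hskew u (cyc V f₁ E), hskew u (monom 1 0 f₂),
    adCyc]
  congr 1
  abel

/-- The properties of `V ⊗ g((z⁻¹))` and of `f₁`, `f₂`, `E` on which the reduction to normal form
rests. `R` is a pseudo-inverse of `ad (f₁ + z E)`. -/
structure IsReductionDatum (D : Derivation F V V) (h f₁ f₂ E : g) (κ : ℤ)
    (R : Module.End F (Loop F V g)) : Prop where
  fil : CompleteFiltration (loopFil F V h κ)
  splitting : IsSplitting (loopFil F V h κ) (adCyc F V f₁ E) R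
  deriv_mem : ∀ (j : ℤ), ∀ x ∈ loopFil F V h κ j, loopDeriv g D x ∈ loopFil F V h κ j
  cyc_mem : cyc V (f₁ + f₂) E ∈ loopFil F V h κ (-2)
  lie_f₁_f₂ : ⁅f₁, f₂⁆ = 0
  lie_f₂_E : ⁅f₂, E⁆ = 0
  comm_cyc : Commute (LieAlgebra.ad F (Loop F V g) (monom 1 0 f₂)) (adCyc F V f₁ E)
  comm_R : Commute (LieAlgebra.ad F (Loop F V g) (monom 1 0 f₂)) R
  map_f₂ : ∀ j, ∀ x ∈ loopFil F V h κ j,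
    LieAlgebra.ad F (Loop F V g) (monom 1 0 f₂) x ∈ loopFil F V h κ (j - 2)
  nilpotent : IsNilpotent (LieAlgebra.ad F (Loop F V g) (monom 1 0 f₂))

namespace IsReductionDatum

variable {R : Module.End F (Loop F V g)} (hR : IsReductionDatum D h f₁ f₂ E κ R)
include hR

lemma tildeFil_complete : CompleteFiltration (tildeFil D h κ) :=
  hR.fil.semiDirect fun c j x hx => Submodule.smul_mem _ c (hR.deriv_mem j x hx)

lemma lie_sub_deriv_mem {d : ℤ} {u x : Loop F V g} (hu : u ∈ loopFil F V h κ d)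
    (hx : x ∈ loopFil F V h κ (-1)) :
    LieAlgebra.ad F (Loop F V g) u x - loopDeriv g D u ∈ loopFil F V h κ (d - 1) :=
  sub_mem (hR.fil.lie_mem hu hx) (hR.fil.mem_of_le (hR.deriv_mem d u hu) (by lia))

/-- Uniqueness for the linearized equation: if `⁅u, ∂ + f + z E + x⁆` has, modulo the kernel of
`ad (f₁ + z E)`, a higher degree than expected, then so has `u ∈ im ad (f₁ + z E)`. -/
lemma mem_of_lie_sub_mem {d : ℤ} {u x q : Loop F V g} (hu : u ∈ LinearMap.range (adCyc F V f₁ E))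
    (hud : u ∈ loopFil F V h κ d) (hx : x ∈ loopFil F V h κ (-1))
    (hq : q ∈ LinearMap.ker (adCyc F V f₁ E))
    (hmem : ⁅incl D u, dPlus D (cyc V (f₁ + f₂) E + x)⁆ - incl D q ∈ tildeFil D h κ (-2 + d + 1)) :
    u ∈ loopFil F V h κ (d + 1) := by
  rw [lie_incl_dPlus_cyc, ← incl_sub, incl_mem_tildeFil,
    show -2 + d + 1 = d - 1 by ring] at hmem
  have := sub_mem (hR.lie_sub_deriv_mem hud hx) hmem
  have := hR.splitting.mem_of_apply_mem hR.comm_cyc hR.comm_R hR.map_f₂ hR.nilpotent hu hq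
    (j := d - 1) (by
      convert this using 1
      abel)
  convert this using 2
  ring

lemma dPlus_mem {x : Loop F V g} (hx : x ∈ loopFil F V h κ (-1)) :
    dPlus D (cyc V (f₁ + f₂) E + x) ∈ tildeFil D h κ (-2) :=
  dPlus_mem_tildeFil (by norm_num) (add_mem hR.cyc_mem (hR.fil.mem_of_le hx (by norm_num)))

/-- Exponentials of elements of `ker ad (f₁ + z E)` take normal forms to normal forms: they fix
`f₁ + z E`, and `∂ + f + z E + y` commutes with `f₁ + z E` if and only if `y` does. -/
lemma exp_centralizer_apply {S H : Loop F V g}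
    (hSk : S ∈ LinearMap.ker (adCyc F V f₁ E))
    (hHk : H ∈ LinearMap.ker (adCyc F V f₁ E)) (hH1 : H ∈ loopFil F V h κ (-1))
    {τ : Tilde g D ≃ₗ⁅F⁆ Tilde g D} (hτ : IsExp (tildeFil D h κ) (incl D S) τ) :
    ∃ H' ∈ LinearMap.ker (adCyc F V f₁ E), H' ∈ loopFil F V h κ (-1) ∧
      τ (dPlus D (cyc V (f₁ + f₂) E + H)) = dPlus D (cyc V (f₁ + f₂) E + H') := by
  have hTF := hR.tildeFil_complete
  set X := dPlus D (cyc V (f₁ + f₂) E + H) with hX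
  have hsub := isExp_sub_mem hτ (hR.dPlus_mem hH1)
  obtain ⟨y, hy⟩ : ∃ y, τ X - X = incl D y := exists_incl_of_right_eq_zero (by
    change (τ X).right - X.right = 0
    rw [right_exp_apply hTF hτ, sub_self])
  rw [hy] at hsub
  have hy1 : y ∈ loopFil F V h κ (-1) := incl_mem_tildeFil.1 hsub
  have hτX : τ X = dPlus D (cyc V (f₁ + f₂) E + (H + y)) := by
    rw [sub_eq_iff_eq_add.1 hy, eq_comm, ← sub_eq_iff_eq_add, hX, dPlus_sub_dPlus]
    congr 1
    abel
  have hz : ∀ Z, ⁅incl D (cyc V f₁ E), dPlus D (cyc V (f₁ + f₂) E + Z)⁆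
      = incl D (adCyc F V f₁ E Z) := by
    intro Z
    rw [lie_incl_dPlus, loopDeriv_cyc, cyc_add, map_add, map_add,
      lie_cyc_monom hR.lie_f₁_f₂ hR.lie_f₂_E,
      LieAlgebra.ad_apply _ _ (cyc V f₁ E) (cyc V f₁ E), lie_self, add_zero, zero_add, sub_zero,
      adCyc]
  have hτc : τ (incl D (cyc V f₁ E)) = incl D (cyc V f₁ E) := by
    have hpow : ∀ k : ℕ, ((LieAlgebra.ad F (Tilde g D) (incl D S)) ^ (k + 1)) (incl D (cyc V f₁ E))
        = 0 := by
      intro k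
      rw [pow_succ, Module.End.mul_apply, LieAlgebra.ad_apply]
      have h0 : LieAlgebra.ad F (Loop F V g) (cyc V f₁ E) S = 0 := hSk
      rw [LieAlgebra.ad_apply] at h0
      have : ⁅incl D S, incl D (cyc V f₁ E)⁆ = 0 := by
        rw [incl, incl, ← LieHom.map_lie, ← lie_skew, h0, neg_zero, map_zero]
      rw [this, map_zero]
    have hpart : ∀ n : ℕ, expPart F (incl D S) (n + 1) (incl D (cyc V f₁ E))
        = incl D (cyc V f₁ E) := by
      intro n
      simp only [expPart, LinearMap.sum_apply, LinearMap.smul_apply]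
      rw [Finset.sum_range_succ', Finset.sum_eq_zero fun k _ => by rw [hpow, smul_zero]]
      simp
    obtain ⟨j, hj⟩ := hTF.exh (incl D (cyc V f₁ E))
    rw [← sub_eq_zero]
    refine hTF.eq_zero_of_nat _ j fun n => ?_
    have := hτ j _ hj (n + 1)
    rw [hpart] at this
    exact hTF.mem_of_le this (by push_cast; lia)
  refine ⟨H + y, ?_, add_mem hH1 hy1, hτX⟩
  have h1 := LieEquiv.map_lie τ (incl D (cyc V f₁ E)) X
  have h0 : incl D (0 : Loop F V g) = 0 := map_zero _
  rw [hz, hHk, h0, map_zero, hτc, hτX, hz, ← h0] at h1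
  exact (incl_injective h1).symm

/-- The image in `F ∂ ⋉ (V ⊗ g((z⁻¹)))` of the range of a projection that preserves degrees is
closed. -/
lemma mem_map_incl {ϖ : Module.End F (Loop F V g)}
    (hϖ : ∀ j, ∀ x ∈ loopFil F V h κ j, ϖ x ∈ loopFil F V h κ j) {W : Submodule F (Loop F V g)}
    (hW : ∀ x, x ∈ W ↔ ϖ x = x) {x : Tilde g D}
    (hx : ∀ j, ∃ p ∈ W.map (LieAlgebra.SemiDirectSum.inl (derivAction g D)).toLinearMap,
      x - p ∈ tildeFil D h κ j) :
    x ∈ W.map (LieAlgebra.SemiDirectSum.inl (derivAction g D)).toLinearMap := by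
  obtain ⟨_, ⟨p, hp, rfl⟩, hxp⟩ := hx 1
  obtain ⟨y, -, hy⟩ := exists_inl_of_mem_semiDirectFil one_pos hxp
  obtain rfl : x = incl D (y + p) := by
    rw [incl_add]
    exact sub_eq_iff_eq_add.1 hy
  refine ⟨y + p, (hW _).2 ?_, rfl⟩
  rw [← sub_eq_zero]
  refine hR.fil.sep _ fun j => ?_
  obtain ⟨_, ⟨v, hv, rfl⟩, hxv⟩ := hx j
  have h1 : y + p - v ∈ loopFil F V h κ j := by
    rw [← incl_mem_tildeFil (D := D), incl_sub]
    exact hxv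
  have h2 := sub_mem (hϖ j _ h1) h1
  rwa [map_sub, (hW v).1 hv, sub_sub_sub_cancel_right] at h2

variable [CharZero F]

/-- Existence of the normal form of `∂ + f + z E + x`. -/
theorem exists_reduction {x : Loop F V g} (hx : x ∈ loopFil F V h κ (-1)) :
    ∃ U ∈ LinearMap.range (adCyc F V f₁ E), U ∈ loopFil F V h κ 1 ∧
      ∃ H ∈ LinearMap.ker (adCyc F V f₁ E), H ∈ loopFil F V h κ (-1) ∧
        ∀ φ : Tilde g D → Tilde g D, IsExp (tildeFil D h κ) (incl D U) φ →
          φ (dPlus D (cyc V (f₁ + f₂) E + x)) = dPlus D (cyc V (f₁ + f₂) E + H) := by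
  have hTF := hR.tildeFil_complete
  have hsplit := hR.splitting
  have hX := hR.dPlus_mem hx
  obtain ⟨N, hN⟩ := hR.nilpotent
  have hright : ∀ z : Loop F V g, (dPlus D z : Tilde g D).right = 1 := fun z => by
    simp [dPlus, incl]
  obtain ⟨_, ⟨U, hU, rfl⟩, hU1, _, ⟨H, hH, rfl⟩, hH1, hexp⟩ := hTF.exists_exp_eq
    (X' := dPlus D (cyc V (f₁ + f₂) E))
    ((LinearMap.range (adCyc F V f₁ E)).map
      (LieAlgebra.SemiDirectSum.inl (derivAction g D)).toLinearMap)
    ((LinearMap.ker (adCyc F V f₁ E)).map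
      (LieAlgebra.SemiDirectSum.inl (derivAction g D)).toLinearMap)
    (LinearMap.range (LieAlgebra.SemiDirectSum.inl (derivAction g D)).toLinearMap)
    (fun y hy => hR.mem_map_incl (ϖ := adCyc F V f₁ E * R) (fun j z hz => hsplit.proj_mem hz)
      (fun z => hsplit.mem_range_iff) hy)
    (fun y hy => hR.mem_map_incl (ϖ := 1 - adCyc F V f₁ E * R)
      (fun j z hz => sub_mem hz (hsplit.proj_mem hz))
      (fun z => hsplit.mem_ker_iff.trans (by simp)) hy)
    hX
    (by
      rw [dPlus_sub_dPlus, add_sub_cancel_left]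
      exact incl_mem_tildeFil.2 hx)
    (by
      rintro _ ⟨U, hU, rfl⟩ hU1 φ hφ
      obtain ⟨y, hy⟩ := exists_incl_of_right_eq_zero (D := D)
        (x := φ (dPlus D (cyc V (f₁ + f₂) E + x)) - dPlus D (cyc V (f₁ + f₂) E)) (by
          change (φ _).right - (dPlus D _).right = 0
          rw [right_exp_apply hTF hφ, hright, hright, sub_self])
      exact ⟨y, hy.symm⟩)
    (by
      rintro _ ⟨y, -, rfl⟩
      exact ⟨y, rfl⟩)
    (by
      rintro d hd _ ⟨y, rfl⟩ hy
      have hy' : y ∈ loopFil F V h κ (-2 + d) := incl_mem_tildeFil.1 hy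
      obtain ⟨u, hu, hud, hup⟩ := hsplit.exists_solution hR.comm_cyc hR.comm_R hR.map_f₂ N
        (j := -2 + d) (p := adCyc F V f₁ E (R y)) ⟨R y, rfl⟩ (hsplit.proj_mem hy')
        (by rw [hN, LinearMap.zero_apply])
      rw [show -2 + d + 2 = d by ring] at hud
      refine ⟨incl D u, ⟨u, hu, rfl⟩, incl_mem_tildeFil.2 hud,
        incl D (y - adCyc F V f₁ E (R y)), ⟨_, hsplit.sub_proj_mem_ker y, rfl⟩,
        incl_mem_tildeFil.2 (sub_mem hy' (hsplit.proj_mem hy')), ?_⟩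
      rw [lie_incl_dPlus_cyc, hup]
      change incl D y + _ - _ ∈ _
      rw [← incl_add, ← incl_sub, incl_mem_tildeFil, show -2 + d + 1 = d - 1 by ring]
      convert hR.lie_sub_deriv_mem hud hx using 1
      abel)
  refine ⟨U, hU, incl_mem_tildeFil.1 hU1, H, hH, incl_mem_tildeFil.1 hH1, fun φ hφ => ?_⟩
  rw [hexp φ hφ, eq_comm, ← sub_eq_iff_eq_add', dPlus_sub_dPlus, add_sub_cancel_left]
  rfl

omit [CharZero F] in
/-- Uniqueness of the normal form and of the exponent in `im ad (f₁ + z E)`. -/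
theorem reduction_unique {x U U' H H' : Loop F V g} {φ φ' : Tilde g D → Tilde g D}
    (hx : x ∈ loopFil F V h κ (-1))
    (hU : U ∈ LinearMap.range (adCyc F V f₁ E)) (hU1 : U ∈ loopFil F V h κ 1)
    (hU' : U' ∈ LinearMap.range (adCyc F V f₁ E)) (hU1' : U' ∈ loopFil F V h κ 1)
    (hH : H ∈ LinearMap.ker (adCyc F V f₁ E)) (hH' : H' ∈ LinearMap.ker (adCyc F V f₁ E))
    (hφ : IsExp (tildeFil D h κ) (incl D U) φ) (hφ' : IsExp (tildeFil D h κ) (incl D U') φ')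
    (h1 : φ (dPlus D (cyc V (f₁ + f₂) E + x)) = dPlus D (cyc V (f₁ + f₂) E + H))
    (h2 : φ' (dPlus D (cyc V (f₁ + f₂) E + x)) = dPlus D (cyc V (f₁ + f₂) E + H')) :
    U = U' ∧ H = H' := by
  have hTF := hR.tildeFil_complete
  have hadd : ∀ Z, dPlus D (cyc V (f₁ + f₂) E + Z) = dPlus D (cyc V (f₁ + f₂) E) + incl D Z :=
    fun Z => by rw [eq_comm, ← eq_sub_iff_add_eq', dPlus_sub_dPlus, add_sub_cancel_left]
  have hUU : U = U' := incl_injective (D := D) <| hTF.eq_of_exp_eq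
    ((LinearMap.range (adCyc F V f₁ E)).map
      (LieAlgebra.SemiDirectSum.inl (derivAction g D)).toLinearMap)
    ((LinearMap.ker (adCyc F V f₁ E)).map
      (LieAlgebra.SemiDirectSum.inl (derivAction g D)).toLinearMap)
    (hR.dPlus_mem hx)
    (by
      rintro d - _ ⟨u, hu, rfl⟩ hud _ ⟨q, hq, rfl⟩ hmem
      exact incl_mem_tildeFil.2 (hR.mem_of_lie_sub_mem hu (incl_mem_tildeFil.1 hud) hx hq hmem))
    ⟨U, hU, rfl⟩ ⟨U', hU', rfl⟩ (incl_mem_tildeFil.2 hU1) (incl_mem_tildeFil.2 hU1')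
    ⟨H, hH, rfl⟩ ⟨H', hH', rfl⟩ hφ hφ' (h1.trans (hadd H)) (h2.trans (hadd H'))
  subst hUU
  refine ⟨rfl, ?_⟩
  rw [hTF.isExp_unique hφ hφ', h2] at h1
  exact (add_left_cancel (dPlus_injective h1)).symm

/-- An exponential `e^{ad W}` that takes a normal form to a normal form has `W ∈ ker ad (f₁ + z E)`.
With `S` the component of `W` in the kernel and `u = W - S`, the values of `e^{ad W}` and `e^{ad S}`
at the normal form differ by an element of the kernel, and by the bracket with `u` up to higher
degree. -/
theorem mem_ker_of_exp_apply {W H H' : Loop F V g} {σ : Tilde g D ≃ₗ⁅F⁆ Tilde g D}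
    (hW : W ∈ loopFil F V h κ 1) (hH : H ∈ LinearMap.ker (adCyc F V f₁ E))
    (hH1 : H ∈ loopFil F V h κ (-1)) (hH' : H' ∈ LinearMap.ker (adCyc F V f₁ E))
    (hσ : IsExp (tildeFil D h κ) (incl D W) σ)
    (hHH' : σ (dPlus D (cyc V (f₁ + f₂) E + H)) = dPlus D (cyc V (f₁ + f₂) E + H')) :
    W ∈ LinearMap.ker (adCyc F V f₁ E) := by
  have hTF := hR.tildeFil_complete
  have hsplit := hR.splitting
  have hu1 := hsplit.proj_mem hW
  set u := adCyc F V f₁ E (R W) with hu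
  have hS1 : W - u ∈ loopFil F V h κ 1 := sub_mem hW hu1
  have hSk : W - u ∈ LinearMap.ker (adCyc F V f₁ E) := hsplit.sub_proj_mem_ker W
  obtain ⟨τ, hτ⟩ := hTF.exists_exp (incl_mem_tildeFil.2 hS1)
  obtain ⟨H'', hH''k, -, hH''⟩ := hR.exp_centralizer_apply hSk hH hH1 hτ
  rw [hsplit.mem_ker_iff, ← hu]
  refine hR.fil.eq_zero_of_nat _ 1 fun n => ?_
  induction n with
  | zero => simpa using hu1
  | succ n ih =>
    have hWu : incl D W - incl D (W - u) = incl D u := by rw [← incl_sub, sub_sub_cancel]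
    have h1 := hTF.isExp_sub_sub_mem (incl_mem_tildeFil.2 hS1) (incl_mem_tildeFil.2 hW) hτ hσ
      (d := 1 + n) (by rw [hWu]; exact incl_mem_tildeFil.2 ih) (hR.dPlus_mem hH1)
    rw [hWu, hHH', hH'', dPlus_sub_dPlus, add_sub_add_left_eq_sub, ← neg_mem_iff, neg_sub] at h1
    have h2 := hR.mem_of_lie_sub_mem ⟨R W, rfl⟩ ih hH1 (sub_mem hH' hH''k) h1
    push_cast
    rwa [← add_assoc]

end IsReductionDatum

end Reduction

/-! ### Degrees in an orthogonal complement -/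

section Orthogonal

variable {F : Type*} [Field F] [CharZero F] {g : Type*} [LieRing g] [LieAlgebra F g]

lemma apply_eq_zero_of_mem_grade {Φ : LinearMap.BilinForm F g} (hΦinv : Φ.lieInvariant g)
    {h x y : g} {i j : ℤ} (hx : x ∈ grade F h i) (hy : y ∈ grade F h j) (hij : i + j ≠ 0) :
    Φ x y = 0 := by
  have := hΦinv h x y
  rw [mem_grade.1 hx, mem_grade.1 hy, map_smul, map_smul, LinearMap.smul_apply, smul_eq_mul,
    smul_eq_mul] at this
  have h1 : ((i + j : ℤ) : F) * Φ x y = 0 := by push_cast; linear_combination this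
  exact (mul_eq_zero.1 h1).resolve_left (by exact_mod_cast hij)

/-- Elements orthogonal to `g_{≥ 1}` have components of degree at least `-1/2` only, because the
form pairs `g_i` with `g_{-i}`. -/
lemma neg_one_le_of_mem_orthogonal {Φ : LinearMap.BilinForm F g} (hΦnd : Φ.Nondegenerate)
    (hΦinv : Φ.lieInvariant g) {ν : Type*} [Fintype ν] (b : Module.Basis ν F g) {h : g} {d : ν → ℤ}
    (hb : ∀ i, b i ∈ grade F h (d i)) {m : Submodule F g} (hm : gradeSum F h (Set.Ici 2) ≤ m)
    {x : g} (hx : x ∈ Φ.orthogonal m) {k : ν} (hk : b.repr x k ≠ 0) : -1 ≤ d k := by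
  by_contra hlt
  classical
  -- the component of `x` in the degree of `b k`; it is orthogonal to everything
  set y : g := ∑ l, if d l = d k then b.repr x l • b l else 0 with hy
  have hy0 : y = 0 := by
    refine hΦnd.2 y fun z => ?_
    suffices Φ.flip y = 0 from LinearMap.congr_fun this z
    refine b.ext fun l => ?_
    change Φ (b l) y = 0
    by_cases hl : d l + d k = 0
    · have hbm : b l ∈ m := hm (Submodule.mem_iSup_of_mem (d l)
        (Submodule.mem_iSup_of_mem (by simp only [Set.mem_Ici]; lia) (hb l)))
      have h1 : Φ (b l) x = 0 := LinearMap.BilinForm.mem_orthogonal_iff.1 hx _ hbm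
      rw [← h1, hy]
      conv_rhs => rw [← b.sum_repr x]
      rw [map_sum, map_sum]
      refine Finset.sum_congr rfl fun n _ => ?_
      split_ifs with hn
      · rfl
      · rw [map_zero, map_smul, apply_eq_zero_of_mem_grade hΦinv (hb l) (hb n) (by lia), smul_zero]
    · rw [hy, map_sum]
      refine Finset.sum_eq_zero fun n _ => ?_
      split_ifs with hn
      · rw [map_smul, apply_eq_zero_of_mem_grade hΦinv (hb l) (hb n) (by rwa [hn]), smul_zero]
      · exact map_zero _
  apply hk
  have h2 := congrArg (fun z => b.repr z k) hy0
  simp only [hy, map_sum, Finsupp.finsetSum_apply, map_zero, Finsupp.zero_apply] at h2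
  rw [Finset.sum_eq_single k (fun l _ hl => ?_) (by simp)] at h2
  · simpa using h2
  · split_ifs <;> simp [hl]

end Orthogonal

/-! ### Integrable triples -/

section Main

variable {F : Type*} [Field F] [CharZero F] {V : Type*} [CommRing V] [Algebra F V]
  {g : Type*} [LieRing g] [LieAlgebra F g] {h f₁ f₂ E : g} {κ : ℤ}

lemma monom_mem_loopFil {ν : Type*} [Fintype ν] [DecidableEq ν] (b : Module.Basis ν F g) {d : ν → ℤ}
    (hb : ∀ i, b i ∈ grade F h (d i)) {j : ℤ} {x : g} (hx : ∀ k, b.repr x k ≠ 0 → j ≤ d k) (a : V) :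
    monom a 0 x ∈ loopFil F V h κ j := by
  rw [mem_loopFil b hb]
  intro i n hn
  rw [monom, coordT_tmul, HahnSeries.coeff_smul] at hn
  have h1 := hx i (left_ne_zero_of_smul hn)
  have h2 : n = -0 := by
    by_contra hne
    exact right_ne_zero_of_smul hn (HahnSeries.coeff_single_of_ne hne)
  rw [h2]
  simpa using h1

lemma isReductionDatum [FiniteDimensional F g] {ν : Type*} [Fintype ν] [DecidableEq ν]
    (b : Module.Basis ν F g) {d : ν → ℤ} (hb : ∀ i, b i ∈ grade F h (d i))
    {Φ : LinearMap.BilinForm F g} {f : g}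
    (ht : IsIntegrableTriple Φ h f κ f₁ f₂ E) {r : Polynomial F}
    (hr : (LieAlgebra.ad F g (f₁ + E)) ^ 2
      * Polynomial.aeval (LieAlgebra.ad F g (f₁ + E)) r = LieAlgebra.ad F g (f₁ + E))
    (D : Derivation F V V) :
    IsReductionDatum D h f₁ f₂ E κ (quasiInverse V f₁ E κ r) := by
  have hκ : 0 < κ + 2 := by have := ht.one_le; lia
  have hF := loopFil_complete (A := V) b hb hκ
  have hf₂ : (monom 1 0 f₂ : Loop F V g) ∈ loopFil F V h κ (-2) :=
    monom_mem_loopFil b hb (fun k hk => by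
      by_contra hne
      exact hk (repr_eq_zero_of_mem_grade b hb ht.mem_f₂ (by lia))) 1
  have hcomm : Commute (LieAlgebra.ad F (Loop F V g) (monom 1 0 f₂)) (adCyc F V f₁ E) :=
    (commute_ad_of_lie_eq_zero (lie_cyc_monom ht.lie_f₁_f₂ ht.lie_f₂_E)).symm
  refine ⟨hF, isSplitting_loop b hb hκ ht.mem_f₁ ht.mem_E hr,
    fun j x hx => loopDeriv_mem b hb D hx, ?_, ht.lie_f₁_f₂, ht.lie_f₂_E, hcomm,
    commute_quasiInverse hcomm fun s => (commute_mulSeries_ad s _).symm, fun j x hx => ?_,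
    isNilpotent_ad_monom ht.mem_f₂⟩
  · refine add_mem (monom_mem_loopFil b hb (fun k hk => ?_) 1)
      (tmul_mem_loopFil ht.mem_E fun n hn => ?_)
    · by_contra hne
      exact hk (repr_eq_zero_of_mem_grade b hb (add_mem ht.mem_f₁ ht.mem_f₂) (by lia))
    · have : n = -1 := by by_contra hne; exact hn (HahnSeries.coeff_single_of_ne hne)
      simp [this]
  · have := hF.lie_mem hf₂ hx
    rwa [neg_add_eq_sub] at this

end Main

end DrinfeldSokolov

end

theorem mainTheorem5 {F : Type*} [Field F] [IsAlgClosed F] [CharZero F]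
    {g : Type*} [LieRing g] [LieAlgebra F g] [FiniteDimensional F g]
    (Φ : LinearMap.BilinForm F g) (hΦsymm : Φ.IsSymm) (hΦnd : Φ.Nondegenerate)
    (hΦinv : Φ.lieInvariant g)
    (e h f : g) (hs : IsSl2Triple h e f)
    (κ : ℤ) (f₁ f₂ E : g) (htriple : DrinfeldSokolov.IsIntegrableTriple Φ h f κ f₁ f₂ E)
    -- `l` is isotropic in `g_{1/2}`, and `l^⊥` is the centralizer of `E` in `g_{1/2}`
    (l : Submodule F g) (hl : l ≤ DrinfeldSokolov.grade F h 1)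
    (hl_iso : DrinfeldSokolov.IsIsotropic Φ f l)
    (hl_perp : DrinfeldSokolov.omegaOrtho Φ h f l = DrinfeldSokolov.centralizerHalf F h E)
    -- `m = l ⊕ g_{≥ 1}`
    (m : Submodule F g) (hm : m = l ⊔ DrinfeldSokolov.gradeSum F h (Set.Ici 2))
    -- `p` is a complement of `m` with `g_{≤ 0} ⊆ p ⊆ g_{≤ 1/2}`
    (p : Submodule F g) (hmp : IsCompl m p)
    (hp_ge : DrinfeldSokolov.gradeSum F h (Set.Iic 0) ≤ p)
    (hp_le : p ≤ DrinfeldSokolov.gradeSum F h (Set.Iic 1))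
    -- dual bases of `p` and of `m^⊥`
    {ι : Type*} [Fintype ι] [DecidableEq ι] (q : Module.Basis ι F p)
    (qd : Module.Basis ι F (Φ.orthogonal m))
    (hq : ∀ i j, Φ (qd j) (q i) = if i = j then 1 else 0) :
    -- `e^{ad U}` is a well-defined automorphism for every `U` of positive degree
    (∀ U ∈ DrinfeldSokolov.loopGT F (DrinfeldSokolov.DiffPoly F ι) h κ 0,
      ∃! φ, DrinfeldSokolov.IsExpAd (DrinfeldSokolov.diffPolyD F ι) h κ U φ) ∧
    -- existence and uniqueness of `U(z) ∈ V(p) ⊗ 𝔥^⊥_{>0}` and `h(z) ∈ V(p) ⊗ 𝔥_{>-1}`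
    (∃! UH : DrinfeldSokolov.Loop F (DrinfeldSokolov.DiffPoly F ι) g ×
        DrinfeldSokolov.Loop F (DrinfeldSokolov.DiffPoly F ι) g,
      UH.1 ∈ DrinfeldSokolov.hatTensor (DrinfeldSokolov.DiffPoly F ι) h κ
        (DrinfeldSokolov.imAd F f₁ E ⊓ DrinfeldSokolov.loopGT F F h κ 0) ∧
      UH.2 ∈ DrinfeldSokolov.hatTensor (DrinfeldSokolov.DiffPoly F ι) h κ
        (DrinfeldSokolov.kerAd F f₁ E ⊓ DrinfeldSokolov.loopGT F F h κ (-2)) ∧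
      ∃ φ, DrinfeldSokolov.IsExpAd (DrinfeldSokolov.diffPolyD F ι) h κ UH.1 φ ∧
        φ (DrinfeldSokolov.dPlus _ (DrinfeldSokolov.cyc (DrinfeldSokolov.DiffPoly F ι) f E +
            DrinfeldSokolov.qElement fun i => (qd i : g)))
          = DrinfeldSokolov.dPlus _
            (DrinfeldSokolov.cyc (DrinfeldSokolov.DiffPoly F ι) f E + UH.2)) ∧
    -- the solutions of positive degree form one orbit of the `e^{ad S}`, `S ∈ V(p) ⊗ 𝔥_{>0}`;
    -- `φ.trans σ` is the composition `σ ∘ φ`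
    (∀ φ ∈ DrinfeldSokolov.solutionAutomorphisms h f κ f₁ E (fun i => (qd i : g)),
      DrinfeldSokolov.solutionAutomorphisms h f κ f₁ E (fun i => (qd i : g)) =
        {ψ | ∃ S ∈ DrinfeldSokolov.hatTensor (DrinfeldSokolov.DiffPoly F ι) h κ
            (DrinfeldSokolov.kerAd F f₁ E ⊓ DrinfeldSokolov.loopGT F F h κ 0),
          ∃ σ, DrinfeldSokolov.IsExpAd (DrinfeldSokolov.diffPolyD F ι) h κ S σ ∧
            ψ = φ.trans σ}) := by
  open DrinfeldSokolov in
  classical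
  obtain ⟨b, d, hb⟩ := exists_basis_mem_grade (F := F) hs
  have hκ : 0 < κ + 2 := by have := htriple.one_le; lia
  obtain ⟨r, hr⟩ := exists_pow_two_mul_aeval (F := F) (V := g)
    (T := LieAlgebra.ad F g (f₁ + E)) htriple.semisimple
  obtain rfl : f = f₁ + f₂ := htriple.add_eq
  have hR := isReductionDatum b hb htriple hr (diffPolyD F ι)
  have hRF := isSplitting_loop (A := F) b hb hκ htriple.mem_f₁ htriple.mem_E hr
  have hTF := hR.tildeFil_complete
  have hsplit := hR.splitting
  have hD := extendDerivation_sub_mem (Fil := loopFil F (DiffPoly F ι) h κ)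
    (ρ := derivAction g (diffPolyD F ι)) (D := eulerDerivation (DiffPoly F ι) h κ)
    (fun c x => by
      change eulerDerivation (DiffPoly F ι) h κ (c • loopDeriv g (diffPolyD F ι) x) = _
      rw [map_smul, eulerDerivation_loopDeriv]
      rfl)
    (eulerDerivation_sub_mem b hb)
  have hGT0 : loopGT F (DiffPoly F ι) h κ 0 = loopFil F (DiffPoly F ι) h κ 1 := rfl
  have hGT2 : loopGT F (DiffPoly F ι) h κ (-2) = loopFil F (DiffPoly F ι) h κ (-1) := rfl
  -- the completed tensor products with `𝔥^⊥` and `𝔥` are the image and the kernel of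
  -- `ad (f₁ + z E)` with coefficients in `V`
  have him : ∀ s, hatTensor (DiffPoly F ι) h κ (imAd F f₁ E ⊓ loopGT F F h κ s)
      = LinearMap.range (adCyc F (DiffPoly F ι) f₁ E) ⊓ loopGT F (DiffPoly F ι) h κ s :=
    hatTensor_eq_of_projection b hb hκ
      (π := adCyc F F f₁ E * quasiInverse F f₁ E κ r)
      (ϖ := adCyc F (DiffPoly F ι) f₁ E * quasiInverse (DiffPoly F ι) f₁ E κ r)
      (fun a x => by
        rw [Module.End.mul_apply, pureLoop_adCyc, pureLoop_quasiInverse]; rfl)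
      (fun j x hx => hRF.proj_mem hx) (fun j x hx => hsplit.proj_mem hx)
      (fun x => hRF.mem_range_iff.1 ⟨_, rfl⟩)
      (fun x => hRF.mem_range_iff) (fun x => hsplit.mem_range_iff)
  have hker : ∀ s, hatTensor (DiffPoly F ι) h κ (kerAd F f₁ E ⊓ loopGT F F h κ s)
      = LinearMap.ker (adCyc F (DiffPoly F ι) f₁ E) ⊓ loopGT F (DiffPoly F ι) h κ s :=
    hatTensor_eq_of_projection b hb hκ
      (π := 1 - adCyc F F f₁ E * quasiInverse F f₁ E κ r)
      (ϖ := 1 - adCyc F (DiffPoly F ι) f₁ E * quasiInverse (DiffPoly F ι) f₁ E κ r)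
      (fun a x => by
        rw [LinearMap.sub_apply, map_sub, Module.End.mul_apply, pureLoop_adCyc,
          pureLoop_quasiInverse]
        rfl)
      (fun j x hx => sub_mem hx (hRF.proj_mem hx)) (fun j x hx => sub_mem hx (hsplit.proj_mem hx))
      (fun x => by
        have := hRF.mem_ker_iff.1 (hRF.sub_proj_mem_ker x)
        simp only [LinearMap.sub_apply, Module.End.one_apply, Module.End.mul_apply]
        rw [this, sub_zero])
      (fun x => hRF.mem_ker_iff.trans (by simp)) (fun x => hsplit.mem_ker_iff.trans (by simp))
  have hq1 : qElement (fun i => (qd i : g)) ∈ loopFil F (DiffPoly F ι) h κ (-1) :=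
    sum_mem fun i _ => monom_mem_loopFil b hb (fun k hk =>
      neg_one_le_of_mem_orthogonal hΦnd hΦinv b hb (by rw [hm]; exact le_sup_right) (qd i).2 hk) _
  refine ⟨fun U hU => ?_, ?_, fun φ hφ => ?_⟩
  · obtain ⟨φ, hφ⟩ := hTF.exists_exp (incl_mem_tildeFil.2 hU)
    refine ⟨φ, (isExpAd_iff_isExp hTF hU).2 hφ, fun ψ hψ => ?_⟩
    exact LieEquiv.ext fun x => hTF.isExp_unique ((isExpAd_iff_isExp hTF hU).1 hψ) hφ x
  · rw [him, hker, hGT0, hGT2]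
    obtain ⟨U, hU, hU1, H, hH, hH1, hexp⟩ := hR.exists_reduction hq1
    obtain ⟨φ, hφ⟩ := hTF.exists_exp (incl_mem_tildeFil.2 hU1)
    refine ⟨(U, H), ⟨⟨hU, hU1⟩, ⟨hH, hH1⟩, φ, (isExpAd_iff_isExp hTF hU1).2 hφ, hexp φ hφ⟩, ?_⟩
    rintro ⟨U', H'⟩ ⟨⟨hU', hU1'⟩, ⟨hH', -⟩, φ', hφ', h'⟩
    obtain ⟨e1, e2⟩ := hR.reduction_unique hq1 hU' hU1' hU hU1 hH' hH
      ((isExpAd_iff_isExp hTF hU1').1 hφ') hφ h' (hexp φ hφ)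
    exact Prod.ext e1 e2
  · obtain ⟨U, hU, hφ, H, hH, hφH⟩ := hφ
    rw [hker] at hH
    replace hφ := (isExpAd_iff_isExp hTF hU).1 hφ
    have hincl {u : Loop F (DiffPoly F ι) g} (hu : u ∈ loopGT F (DiffPoly F ι) h κ 0) :
        incl (diffPolyD F ι) u ∈ tildeFil (diffPolyD F ι) h κ 1 := incl_mem_tildeFil.2 hu
    ext ψ
    constructor
    · rintro ⟨U', hU', hψ, H', hH', hψH⟩
      rw [hker] at hH'
      replace hψ := (isExpAd_iff_isExp hTF hU').1 hψ
      -- `ψ ∘ φ⁻¹` is an exponential which takes one normal form to another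
      obtain ⟨W, hW, hσ⟩ := hTF.exists_isExp_symm_trans hD (hincl hU) (hincl hU') hφ hψ
      obtain ⟨w, hw, rfl⟩ := exists_inl_of_mem_semiDirectFil one_pos hW
      have hwk := hR.mem_ker_of_exp_apply hw hH.1 hH.2 hH'.1 hσ (by
        rw [LieEquiv.trans_apply, ← hφH, LieEquiv.symm_apply_apply, hψH])
      refine ⟨w, by rw [hker]; exact ⟨hwk, hw⟩, _, (isExpAd_iff_isExp hTF hw).2 hσ, ?_⟩
      exact LieEquiv.ext fun x => by simp
    · rintro ⟨S, hS, σ, hσ, rfl⟩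
      rw [hker] at hS
      replace hσ := (isExpAd_iff_isExp hTF hS.2).1 hσ
      obtain ⟨W, hW, hWe⟩ := hTF.exists_isExp_trans hD (hincl hU) (hincl hS.2) hφ hσ
      obtain ⟨w, hw, rfl⟩ := exists_inl_of_mem_semiDirectFil one_pos hW
      obtain ⟨H', hH'k, hH', hσH⟩ := hR.exp_centralizer_apply hS.1 hH.1 hH.2 hσ
      refine ⟨w, hw, (isExpAd_iff_isExp hTF hw).2 hWe, H', by rw [hker]; exact ⟨hH'k, hH'⟩, ?_⟩
      rw [LieEquiv.trans_apply, hφH, hσH]
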